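/- Let $\mathcal H,\mathcal H_1$ be complex Hilbert spaces, $H$ a selfadjoint operator on $\mathcal H$ with resolvent $R(z)=(H-z)^{-1}$, and $A$ a closed, densely defined linear operator from $\mathcal H$ to $\mathcal H_1$. Let $a\ge 0$ and $\epsilon_0>0$. We say that $A$ is $H$-supersmooth with constant $a$ (for $\epsilon_0$) if $$|(R(\lambda+i\epsilon)A^*v,A^*v)_{\mathcal H}|\le a\|v\|_{\mathcal H_1}^2\qquad\text{for all } v\in D(A^*),\ \lambda,\epsilon\in\mathbb R,\ 0<|\epsilon|<\epsilon_0 .$$ A step function $h:\mathbb R\to D(A^*)$ is a (Bochner) measurable function of bounded support taking finitely many values. Write $\|\cdot\|_{L^2\mathcal H_1}$ for the norm of $L^2(\mathbb R;\mathcal H_1)$. For a constant $C\ge0$ consider the property (E$_C$) for every step function $h:\mathbb R\to D(A^*)$ and every $t\in\mathbb R$, one has $e^{-i(t-s)H}A^*h(s)\in D(A)$ for almost every $s$ between $0$ and $t$, the function $s\mapsto Ae^{-i(t-s)H}A^*h(s)$ is Bochner integrable over $[0,t]$ (or $[t,0]$), and for all $0\le\epsilon<\epsilon_0$ the function $t\mapsto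 e^{-\epsilon|t|}\int_0^tAe^{-i(t-s)H}A^*h(s)\,ds$ belongs to $L^2(\mathbb R;\mathcal H_1)$ with $$\Big\|e^{-\epsilon|t|}\int_0^tAe^{-i(t-s)H}A^*h(s)\,ds\Big\|_{L^2\mathcal H_1}\le C\,\|e^{-\epsilon|t|}h(t)\|_{L^2\mathcal H_1}.$$ (1) If $A$ is $H$-supersmooth with constant $a$ (for $\epsilon_0$), then for every $v\in\mathcal H$ one has $e^{-itH}v\in D(A)$ for almost every $t\in\mathbb R$, and (E$_{2a}$) holds. (2) Conversely, if (E$_{2a}$) holds, then $A$ is $H$-supersmooth with constant $2a$ (for the same $\epsilon_0$). -/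

import Mathlib

open MeasureTheory Set
open scoped ENNReal

namespace KatoSmoothing

noncomputable section

variable {E F : Type*} [NormedAddCommGroup E] [InnerProductSpace ℂ E] [CompleteSpace E]
  [NormedAddCommGroup F] [InnerProductSpace ℂ F] [CompleteSpace F]

/-- The value `A x` of a partially defined operator, as a function on the whole space. It takes the
junk value `0` off the domain; membership in the domain is always required separately below. -/
def val (A : E →ₗ.[ℂ] F) (x : E) : F :=
  open Classical in if hx : x ∈ A.domain then A ⟨x, hx⟩ else 0

/-- The resolvent `R(z) = (H - z)⁻¹`, the inverse of the map `u ↦ H u - z u` on `D(H)`.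
For self-adjoint `H` and non-real `z` that map is a bijection from `D(H)` onto the whole space, so
that this is a genuine two-sided inverse. -/
def res (H : E →ₗ.[ℂ] E) (z : ℂ) (f : E) : E :=
  (Function.invFun (fun u : H.domain => H u - z • (u : E)) f : H.domain)

/-- `U` is a strongly continuous one-parameter unitary group whose infinitesimal generator is
exactly `-iH`: the orbit of `v` is differentiable at `0` with derivative `w` if and only if
`v ∈ D(H)` and `w = -i H v`. -/
structure IsUnitaryGroup (H : E →ₗ.[ℂ] E) (U : ℝ → E →L[ℂ] E) : Prop where
  zero : U 0 = 1
  add : ∀ s t, U (s + t) = U s * U t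
  norm_map : ∀ t v, ‖U t v‖ = ‖v‖
  continuous : ∀ v, Continuous fun t => U t v
  generator : ∀ v w, HasDerivAt (fun t => U t v) w 0 ↔
    ∃ hv : v ∈ H.domain, w = -(Complex.I • H ⟨v, hv⟩)

/-- The propagator `t ↦ e^{-itH}`: the unitary group generated by `-iH`, which for self-adjoint
`H` exists and is unique (Stone's theorem). -/
def propagator (H : E →ₗ.[ℂ] E) : ℝ → E →L[ℂ] E :=
  open Classical in if h : ∃ U, IsUnitaryGroup H U then h.choose else 0

/-- `A` is `H`-supersmooth with constant `a`, with the admissible range `0 < |ε| < ε₀`: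
`|(R(lam + iε) A* v, A* v)| ≤ a ‖v‖²` for `v ∈ D(A*)`. (`A` is `H`-supersmooth with constant `a`
when this holds for some `ε₀ > 0`.) -/
def IsSupersmooth (H : E →ₗ.[ℂ] E) (A : E →ₗ.[ℂ] F) (a ε₀ : ℝ) : Prop :=
  ∀ ε lam : ℝ, 0 < |ε| → |ε| < ε₀ → ∀ v : A.adjoint.domain,
    ‖inner ℂ (res H (lam + ε * Complex.I) (A.adjoint v)) (A.adjoint v)‖ ≤ a * ‖(v : F)‖ ^ 2

/-- A step function: a (Bochner) measurable function of bounded support with finitely many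
values. -/
structure IsStep {D : Type*} [TopologicalSpace D] [Zero D] (h : ℝ → D) : Prop where
  aestronglyMeasurable : AEStronglyMeasurable h volume
  finite_range : (range h).Finite
  bounded_support : Bornology.IsBounded (Function.support h)

/-- The integrand `A e^{-i(t-s)H} A* h(s)`. -/
def integrand (H : E →ₗ.[ℂ] E) (A : E →ₗ.[ℂ] F) (h : ℝ → A.adjoint.domain) (t s : ℝ) : F :=
  val A (propagator H (t - s) (A.adjoint (h s)))

/-- The inhomogeneous estimate with constant `C` in the range `0 ≤ ε < ε₀`. For every step
function `h : ℝ → D(A*)` and every `t`, the function `s ↦ A e^{-i(t-s)H} A* h(s)` is defined almost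
everywhere between `0` and `t` and is Bochner integrable there; and, with
`w(t) = ∫₀ᵗ A e^{-i(t-s)H} A* h(s) ds`, the function `e^{-ε|t|} w(t)` is in `L²(ℝ; F)` with norm
at most `C ‖e^{-ε|t|} h‖`. -/
def InhomogeneousEstimate (H : E →ₗ.[ℂ] E) (A : E →ₗ.[ℂ] F) (C ε₀ : ℝ) : Prop :=
  ∀ h : ℝ → A.adjoint.domain, IsStep h →
    (∀ t : ℝ,
      (∀ᵐ s ∂volume.restrict (uIoc 0 t),
        propagator H (t - s) (A.adjoint (h s)) ∈ A.domain) ∧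
      IntervalIntegrable (integrand H A h t) volume 0 t) ∧
    ∀ ε : ℝ, 0 ≤ ε → ε < ε₀ →
      MemLp (fun t : ℝ => Real.exp (-ε * |t|) • ∫ s in (0 : ℝ)..t, integrand H A h t s) 2 volume ∧
      eLpNorm (fun t : ℝ => Real.exp (-ε * |t|) • ∫ s in (0 : ℝ)..t, integrand H A h t s) 2 volume
        ≤ ENNReal.ofReal C *
          eLpNorm (fun t : ℝ => Real.exp (-ε * |t|) • (h t : F)) 2 volume

end

end KatoSmoothing

/-! The resolvent is the Laplace transform of the group: for `σ = ±1` and `σ Im z > 0`, the integral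
of `e^{iσzτ} e^{-iστH}` over `τ > 0` equals `-iσ R(z)` (`IsUnitaryGroup.integral_Ioi`).
Supersmoothness is thus a bound on the symbol of the causal convolution with kernel `A e^{-itH} A*`,
damped by `e^{-εt}`.

For (1), polarization turns the bound `a` on the quadratic form into a bound `2a` on the
sesquilinear form (`norm_inner_le_of_numerical_radius`). By Plancherel the damped convolution is
then bounded by `2a` in the weak sense, that is, when paired with functions valued in `D(A*)`, so
that `A` need not act on anything (`norm_integral_inner_convolution_le`). Giving sense to `A
e^{-itH}` takes a `TT*` argument. The squared norm of `Y = ∫ e^{isH} A* k(s) ds` is a causal plus an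
anticausal pairing, whence `‖Y‖² ≤ 12a ‖k‖²` (`norm_integral_group_le`). Dually `A e^{-itH} v` is in
`L²`, first for `v ∈ D(H)`, which lies in `D(A)` because `A R(iε)` is bounded, and then for all `v`
because `A` is closed (`IsSupersmooth.smoothing`). The lossy constant is used only for existence and
integrability. The sharp `2a` returns by pairing the Duhamel integral with step functions
(`eLpNorm_duhamel_le`); positive and negative times decouple and recombine in squares.

For (2), the estimate is tested on `h(t) = e^{-ζσt} v` for `0 < σt ≤ L`, where `σ` is the sign of
`ε` and `ζ = iσz`. Pairing the solution with a unimodular multiple of `v` on the same set gives a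
bound `C L ‖v‖²` for the integral over `[0, L]` of the truncated Laplace transforms of `(e^{-iσsH}
A*v, A*v)`. Division by `L` and `L → ∞` leave the form of the resolvent
(`InhomogeneousEstimate.norm_integral_le`, `InhomogeneousEstimate.isSupersmooth`).

Stone's theorem, which makes `propagator` the actual group of `-iH`, is proved by a symmetric Yosida
approximation. -/

set_option linter.unusedSectionVars false

namespace KatoSmoothing

open Filter Topology InnerProductSpace

/-! ### Resolvents, adjoints and numerical radius -/

section Operators

variable {E F : Type*} [NormedAddCommGroup E] [InnerProductSpace ℂ E] [CompleteSpace E]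
  [NormedAddCommGroup F] [InnerProductSpace ℂ F] [CompleteSpace F]

theorem inner_symm_of_isSelfAdjoint {H : E →ₗ.[ℂ] E} (hH : IsSelfAdjoint H) (u v : H.domain) :
    inner ℂ (H u) (v : E) = inner ℂ (u : E) (H v) := by
  have h := LinearPMap.adjoint_isFormalAdjoint hH.dense_domain
  rw [LinearPMap.isSelfAdjoint_def.1 hH] at h
  exact h u v

/-- The maximality half of self-adjointness, `D(H*) ⊆ D(H)`. It yields surjectivity of `H - z` and
identifies the generator in Stone's theorem. -/
theorem mem_domain_of_isSelfAdjoint {H : E →ₗ.[ℂ] E} (hH : IsSelfAdjoint H) {y w : E}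
    (h : ∀ x : H.domain, inner ℂ w (x : E) = inner ℂ y (H x)) :
    ∃ hy : y ∈ H.domain, H ⟨y, hy⟩ = w := by
  have key : ∃ hy : y ∈ H.adjoint.domain, H.adjoint ⟨y, hy⟩ = w :=
    ⟨LinearPMap.mem_adjoint_domain_of_exists y ⟨w, h⟩,
      LinearPMap.adjoint_apply_eq hH.dense_domain _ h⟩
  rwa [LinearPMap.isSelfAdjoint_def.1 hH] at key

/-- The map `u ↦ H u - z u` on `D(H)`. -/
def subSMul (H : E →ₗ.[ℂ] E) (z : ℂ) : H.domain →ₗ[ℂ] E :=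
  H.toFun - z • H.domain.subtype

theorem subSMul_apply (H : E →ₗ.[ℂ] E) (z : ℂ) (u : H.domain) :
    subSMul H z u = H u - z • (u : E) := rfl

theorem im_inner_subSMul {H : E →ₗ.[ℂ] E} (hH : IsSelfAdjoint H) (z : ℂ) (u : H.domain) :
    (inner ℂ (u : E) (subSMul H z u)).im = -z.im * ‖(u : E)‖ ^ 2 := by
  have h1 : (inner ℂ (u : E) (H u)).im = 0 := by
    have := inner_symm_of_isSelfAdjoint hH u u
    rw [← inner_conj_symm] at this
    exact Complex.conj_eq_iff_im.1 this
  rw [subSMul_apply, inner_sub_right, inner_smul_right, inner_self_eq_norm_sq_to_K,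
    Complex.sub_im, h1]
  norm_cast
  simp [Complex.mul_im]
  norm_cast
  simp

/-- Since `⟪u, H u⟫` is real, only `-z u` contributes to the imaginary part of `⟪u, (H - z) u⟫`;
Cauchy–Schwarz does the rest. Injectivity, closed range and the resolvent bound all come from this
inequality. -/
theorem norm_le_norm_subSMul {H : E →ₗ.[ℂ] E} (hH : IsSelfAdjoint H) (z : ℂ) (u : H.domain) :
    |z.im| * ‖(u : E)‖ ≤ ‖subSMul H z u‖ := by
  rcases eq_or_ne (‖(u : E)‖) 0 with h0 | h0
  · simp [h0]
  have h1 := im_inner_subSMul hH z u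
  have h2 : |z.im| * ‖(u : E)‖ ^ 2 ≤ ‖(u : E)‖ * ‖subSMul H z u‖ := by
    calc |z.im| * ‖(u : E)‖ ^ 2 = |(inner ℂ (u : E) (subSMul H z u)).im| := by
          rw [h1, abs_mul, abs_neg, abs_of_nonneg (sq_nonneg ‖(u : E)‖)]
      _ ≤ ‖inner ℂ (u : E) (subSMul H z u)‖ := Complex.abs_im_le_norm _
      _ ≤ _ := norm_inner_le_norm _ _
  have h3 : 0 < ‖(u : E)‖ := lt_of_le_of_ne (norm_nonneg _) h0.symm
  refine le_of_mul_le_mul_left ?_ h3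
  linarith [h2, sq ‖(u : E)‖, mul_assoc (|z.im|) ‖(u : E)‖ ‖(u : E)‖,
    mul_comm ‖(u : E)‖ (|z.im| * ‖(u : E)‖)]

theorem subSMul_injective {H : E →ₗ.[ℂ] E} (hH : IsSelfAdjoint H) {z : ℂ} (hz : z.im ≠ 0) :
    Function.Injective (subSMul H z) := by
  refine (injective_iff_map_eq_zero _).2 fun u hu => ?_
  have := norm_le_norm_subSMul hH z u
  rw [hu, norm_zero] at this
  have h0 : ‖(u : E)‖ = 0 :=
    le_antisymm (nonpos_of_mul_nonpos_right this (abs_pos.2 hz)) (norm_nonneg _)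
  exact Subtype.ext (norm_eq_zero.1 h0)

theorem graph_limit {A : E →ₗ.[ℂ] F} (hA : A.IsClosed) {ι : Type*} {l : Filter ι} [l.NeBot]
    {u : ι → A.domain} {x : E} {y : F} (hx : Tendsto (fun i => (u i : E)) l (𝓝 x))
    (hy : Tendsto (fun i => A (u i)) l (𝓝 y)) : ∃ hx : x ∈ A.domain, A ⟨x, hx⟩ = y := by
  have : (x, y) ∈ (A.graph : Set (E × F)) :=
    IsClosed.mem_of_tendsto hA (hx.prodMk_nhds hy)
      (Eventually.of_forall fun i => A.mem_graph (u i))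
  obtain ⟨w, hw1, hw2⟩ := (LinearPMap.mem_graph_iff A).1 this
  simp only at hw1 hw2
  subst hw1
  exact ⟨w.2, hw2⟩

/-- The range is closed by the lower bound and closedness of `H`. Its orthogonal complement is the
kernel of `H - z̄`, which is trivial by injectivity at `z̄`. -/
theorem subSMul_surjective {H : E →ₗ.[ℂ] E} (hH : IsSelfAdjoint H) {z : ℂ} (hz : z.im ≠ 0) :
    Function.Surjective (subSMul H z) := by
  have hpos : 0 < |z.im| := abs_pos.2 hz
  have hclosed : IsClosed (LinearMap.range (subSMul H z) : Set E) := by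
    refine IsSeqClosed.isClosed fun f x hf hx => ?_
    choose u hu using hf
    have hbd : ∀ m n, dist (u m : E) (u n) ≤ |z.im|⁻¹ * dist (f m) (f n) := fun m n => by
      rw [dist_eq_norm, dist_eq_norm, ← hu, ← hu, ← map_sub, ← AddSubgroupClass.coe_sub,
        inv_mul_eq_div, le_div_iff₀ hpos, mul_comm]
      exact norm_le_norm_subSMul hH z _
    have hc : CauchySeq fun n => (u n : E) := by
      have hfc := hx.cauchySeq
      rw [Metric.cauchySeq_iff] at hfc ⊢
      intro ε hε
      obtain ⟨N, hN⟩ := hfc (|z.im| * ε) (by positivity)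
      refine ⟨N, fun m hm n hn => (hbd m n).trans_lt ?_⟩
      rw [inv_mul_lt_iff₀ hpos]
      exact hN m hm n hn
    obtain ⟨v, hv⟩ := cauchySeq_tendsto_of_complete hc
    have hHu : Tendsto (fun n => H (u n)) atTop (𝓝 (x + z • v)) := by
      refine (hx.add (hv.const_smul z)).congr fun n => ?_
      rw [← hu n, subSMul_apply, sub_add_cancel]
    obtain ⟨hvd, hHv⟩ := graph_limit hH.isClosed hv hHu
    refine ⟨⟨v, hvd⟩, ?_⟩
    rw [subSMul_apply, hHv, add_sub_cancel_right]
  have horth : (LinearMap.range (subSMul H z))ᗮ = ⊥ := by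
    rw [Submodule.eq_bot_iff]
    intro y hy
    rw [Submodule.mem_orthogonal'] at hy
    have hy' : ∀ x : H.domain, inner ℂ ((starRingEnd ℂ z) • y) (x : E) = inner ℂ y (H x) := by
      intro x
      have := hy _ ⟨x, rfl⟩
      rw [subSMul_apply, inner_sub_right, inner_smul_right, sub_eq_zero] at this
      rw [inner_smul_left, this, RingHomCompTriple.comp_apply, RingHom.id_apply]
    obtain ⟨hyd, hHy⟩ := mem_domain_of_isSelfAdjoint hH hy'
    have h0 : subSMul H (starRingEnd ℂ z) ⟨y, hyd⟩ = 0 := by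
      rw [subSMul_apply, hHy, sub_self]
    have := subSMul_injective hH (z := starRingEnd ℂ z) (by simpa using hz)
      (h0.trans (map_zero _).symm)
    exact congrArg Subtype.val this
  have : (LinearMap.range (subSMul H z)) = ⊤ := by
    rw [← hclosed.submodule_topologicalClosure_eq, Submodule.topologicalClosure_eq_top_iff, horth]
  exact LinearMap.range_eq_top.1 this

theorem res_spec {H : E →ₗ.[ℂ] E} (hH : IsSelfAdjoint H) {z : ℂ} (hz : z.im ≠ 0) (f : E) :
    ∃ u : H.domain, (u : E) = res H z f ∧ subSMul H z u = f :=
  ⟨_, rfl, Function.invFun_eq (f := fun u : H.domain => H u - z • (u : E))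
    (subSMul_surjective hH hz f)⟩

theorem res_subSMul {H : E →ₗ.[ℂ] E} (hH : IsSelfAdjoint H) {z : ℂ} (hz : z.im ≠ 0)
    (u : H.domain) : res H z (subSMul H z u) = u := by
  obtain ⟨w, hw, h⟩ := res_spec hH hz (subSMul H z u)
  rw [← hw, subSMul_injective hH hz h]

theorem norm_res_le {H : E →ₗ.[ℂ] E} (hH : IsSelfAdjoint H) {z : ℂ} (hz : z.im ≠ 0) (f : E) :
    ‖res H z f‖ ≤ |z.im|⁻¹ * ‖f‖ := by
  obtain ⟨u, hu, rfl⟩ := res_spec hH hz f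
  rw [← hu, inv_mul_eq_div, le_div_iff₀ (abs_pos.2 hz), mul_comm]
  exact norm_le_norm_subSMul hH z u

/-- The resolvent as a bounded operator. -/
noncomputable def resCLM {H : E →ₗ.[ℂ] E} (hH : IsSelfAdjoint H) {z : ℂ} (hz : z.im ≠ 0) :
    E →L[ℂ] E :=
  LinearMap.mkContinuous
    { toFun := res H z
      map_add' := fun f g => by
        obtain ⟨u, hu, rfl⟩ := res_spec hH hz f
        obtain ⟨v, hv, rfl⟩ := res_spec hH hz g
        rw [← map_add, res_subSMul hH hz, res_subSMul hH hz, res_subSMul hH hz, Submodule.coe_add]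
      map_smul' := fun c f => by
        obtain ⟨u, hu, rfl⟩ := res_spec hH hz f
        rw [← map_smul, res_subSMul hH hz, res_subSMul hH hz, Submodule.coe_smul,
          RingHom.id_apply] }
    |z.im|⁻¹ (norm_res_le hH hz)

@[simp] theorem resCLM_apply {H : E →ₗ.[ℂ] E} (hH : IsSelfAdjoint H) {z : ℂ} (hz : z.im ≠ 0)
    (f : E) : resCLM hH hz f = res H z f := rfl

theorem inner_res_left {H : E →ₗ.[ℂ] E} (hH : IsSelfAdjoint H) {z : ℂ} (hz : z.im ≠ 0)
    (f g : E) : inner ℂ (res H z f) g = inner ℂ f (res H (starRingEnd ℂ z) g) := by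
  have hz' : (starRingEnd ℂ z).im ≠ 0 := by simpa using hz
  obtain ⟨u, hu, rfl⟩ := res_spec hH hz f
  obtain ⟨v, hv, rfl⟩ := res_spec hH hz' g
  rw [res_subSMul hH hz, res_subSMul hH hz', subSMul_apply, subSMul_apply, inner_sub_left,
    inner_sub_right, inner_smul_left, inner_smul_right, inner_symm_of_isSelfAdjoint hH]

/-- Through this identity a bound on the quadratic form of the resolvent controls the norm of `R(z)
f` itself. -/
theorem im_inner_res {H : E →ₗ.[ℂ] E} (hH : IsSelfAdjoint H) {z : ℂ} (hz : z.im ≠ 0) (f : E) :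
    (inner ℂ (res H z f) f).im = -z.im * ‖res H z f‖ ^ 2 := by
  obtain ⟨u, hu, rfl⟩ := res_spec hH hz f
  rw [res_subSMul hH hz, im_inner_subSMul hH]

theorem isFormalAdjoint_apply {A : E →ₗ.[ℂ] F} (hAd : Dense (A.domain : Set E))
    (w : A.adjoint.domain) (x : A.domain) :
    inner ℂ (A.adjoint w) (x : E) = inner ℂ (w : F) (A x) :=
  LinearPMap.adjoint_isFormalAdjoint hAd w x

/-- A closed densely defined operator is its own second adjoint. -/
theorem mem_domain_of_inner_adjoint {A : E →ₗ.[ℂ] F} (hA : A.IsClosed)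
    (hAd : Dense (A.domain : Set E)) {x : E} {y : F}
    (h : ∀ w : A.adjoint.domain, inner ℂ (A.adjoint w) x = inner ℂ (w : F) y) :
    ∃ hx : x ∈ A.domain, A ⟨x, hx⟩ = y := by
  -- The graph is viewed in the Hilbert sum, where a closed subspace equals its double orthogonal
  -- complement. Vectors orthogonal to the graph have the form `(-A* w, w)`, so the hypothesis
  -- places `(x, y)` in the double complement.
  let K : Submodule ℂ (WithLp 2 (E × F)) :=
    A.graph.comap (WithLp.linearEquiv 2 ℂ (E × F) : WithLp 2 (E × F) →ₗ[ℂ] E × F)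
  have hK : IsClosed (K : Set (WithLp 2 (E × F))) :=
    IsClosed.preimage (WithLp.prod_continuous_ofLp 2 E F) hA
  have hmem : WithLp.toLp 2 (x, y) ∈ Kᗮᗮ := by
    rw [Submodule.mem_orthogonal]
    intro p hp
    rw [Submodule.mem_orthogonal'] at hp
    have hp' : ∀ u : A.domain, inner ℂ (-p.fst) (u : E) = inner ℂ p.snd (A u) := by
      intro u
      have := hp (WithLp.toLp 2 ((u : E), A u)) (A.mem_graph u)
      rw [WithLp.prod_inner_apply] at this
      simp only at this
      rw [inner_neg_left, neg_eq_iff_add_eq_zero]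
      exact this
    have hs : p.snd ∈ A.adjoint.domain := LinearPMap.mem_adjoint_domain_of_exists _ ⟨_, hp'⟩
    have hv : A.adjoint ⟨p.snd, hs⟩ = -p.fst := LinearPMap.adjoint_apply_eq hAd _ hp'
    have := h ⟨p.snd, hs⟩
    rw [hv, inner_neg_left, neg_eq_iff_add_eq_zero] at this
    rw [WithLp.prod_inner_apply]
    exact this
  have : CompleteSpace K := hK.completeSpace_coe
  rw [Submodule.orthogonal_orthogonal] at hmem
  have hg : (x, y) ∈ A.graph := hmem
  obtain ⟨w, hw1, hw2⟩ := (LinearPMap.mem_graph_iff A).1 hg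
  simp only at hw1 hw2
  subst hw1
  exact ⟨w.2, hw2⟩

/-- A vector `y` orthogonal to `D(A*)` makes `(0, y)` a point of the graph of `A`, so `y = A 0 = 0`.
-/
theorem dense_adjoint_domain {A : E →ₗ.[ℂ] F} (hA : A.IsClosed)
    (hAd : Dense (A.domain : Set E)) : Dense (A.adjoint.domain : Set F) := by
  rw [Submodule.dense_iff_topologicalClosure_eq_top, Submodule.topologicalClosure_eq_top_iff,
    Submodule.eq_bot_iff]
  intro y hy
  rw [Submodule.mem_orthogonal] at hy
  obtain ⟨h0, h1⟩ := mem_domain_of_inner_adjoint hA hAd (x := 0) (y := y) fun w => by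
    rw [inner_zero_right, hy _ w.2]
  rw [← h1]
  exact map_zero A.toFun

/-- If `w ↦ ⟪A* w, x⟫` is bounded by `M ‖w‖`, then `x ∈ D(A)` and `‖A x‖ ≤ M`. -/
theorem mem_domain_of_bound {A : E →ₗ.[ℂ] F} (hA : A.IsClosed)
    (hAd : Dense (A.domain : Set E)) {x : E} {M : ℝ} (hM : 0 ≤ M)
    (h : ∀ w : A.adjoint.domain, ‖inner ℂ (A.adjoint w) x‖ ≤ M * ‖(w : F)‖) :
    ∃ hx : x ∈ A.domain, ‖A ⟨x, hx⟩‖ ≤ M := by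
  -- The inner product is flipped to be linear in `w`. Hahn–Banach extends the functional with the
  -- same norm, and its Riesz representative is the candidate for `A x`.
  let ℓ : A.adjoint.domain →L[ℂ] ℂ := LinearMap.mkContinuous
    ((innerSL ℂ x).toLinearMap.comp A.adjoint.toFun) M fun w => by
      have := h w
      rwa [norm_inner_symm] at this
  obtain ⟨ℓ', hℓ, hn⟩ := exists_extension_norm_eq A.adjoint.domain ℓ
  let y : F := (InnerProductSpace.toDual ℂ F).symm ℓ'
  have hy : ∀ w : F, inner ℂ y w = ℓ' w := fun w => InnerProductSpace.toDual_symm_apply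
  obtain ⟨hx, hxy⟩ := mem_domain_of_inner_adjoint hA hAd (x := x) (y := y) fun w => by
    rw [← inner_conj_symm, ← inner_conj_symm (w : F) y, hy, hℓ w]
    rfl
  refine ⟨hx, ?_⟩
  rw [hxy]
  calc ‖y‖ = ‖ℓ'‖ := by simp [y]
    _ = ‖ℓ‖ := hn
    _ ≤ M := LinearMap.mkContinuous_norm_le _ hM _

theorem val_of_mem {A : E →ₗ.[ℂ] F} {x : E} (hx : x ∈ A.domain) : val A x = A ⟨x, hx⟩ := by
  rw [val, dif_pos hx]

theorem inner_val {A : E →ₗ.[ℂ] F} (hAd : Dense (A.domain : Set E)) (w : A.adjoint.domain)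
    {x : E} (hx : x ∈ A.domain) : inner ℂ (w : F) (val A x) = inner ℂ (A.adjoint w) x := by
  rw [val_of_mem hx, isFormalAdjoint_apply hAd w ⟨x, hx⟩]

/-- A sesquilinear form with numerical radius at most `a` is bounded by `2a`. -/
theorem norm_inner_le_of_numerical_radius {D : Submodule ℂ F} (T : D →ₗ[ℂ] E) (L : E →ₗ[ℂ] E)
    {a : ℝ}
    (h : ∀ v : D, ‖inner ℂ (L (T v)) (T v)‖ ≤ a * ‖(v : F)‖ ^ 2) (v w : D) :
    ‖inner ℂ (L (T v)) (T w)‖ ≤ 2 * a * (‖(v : F)‖ * ‖(w : F)‖) := by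
  have step : ∀ v w : D,
      ‖inner ℂ (L (T v)) (T w)‖ ≤ a * (‖(v : F)‖ ^ 2 + ‖(w : F)‖ ^ 2) := by
    intro v w
    have pol : 4 * inner ℂ (L (T v)) (T w) =
        inner ℂ (L (T (v + w))) (T (v + w)) - inner ℂ (L (T (v - w))) (T (v - w))
        + Complex.I * inner ℂ (L (T (v + Complex.I • w))) (T (v + Complex.I • w)) * (-1)
        - Complex.I * inner ℂ (L (T (v - Complex.I • w))) (T (v - Complex.I • w)) * (-1) := by
      simp only [map_add, map_sub, map_smul, inner_add_left, inner_add_right, inner_sub_left,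
        inner_sub_right, inner_smul_left, inner_smul_right, Complex.conj_I]
      ring_nf
      simp only [Complex.I_sq]
      ring
    have hb1 := h (v + w)
    have hb2 := h (v - w)
    have hb3 := h (v + Complex.I • w)
    have hb4 := h (v - Complex.I • w)
    have p1 := parallelogram_law_with_norm ℂ (v : F) w
    have p2 := parallelogram_law_with_norm ℂ (v : F) (Complex.I • (w : F))
    rw [norm_smul, Complex.norm_I, one_mul] at p2
    simp only [Submodule.coe_add, Submodule.coe_sub, Submodule.coe_smul] at hb1 hb2 hb3 hb4
    have h4 : 4 * ‖inner ℂ (L (T v)) (T w)‖ ≤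
        4 * (a * (‖(v : F)‖ ^ 2 + ‖(w : F)‖ ^ 2)) := by
      calc 4 * ‖inner ℂ (L (T v)) (T w)‖ = ‖4 * inner ℂ (L (T v)) (T w)‖ := by simp
        _ ≤ a * ‖(v : F) + w‖ ^ 2 + a * ‖(v : F) - w‖ ^ 2
            + a * ‖(v : F) + Complex.I • (w : F)‖ ^ 2
            + a * ‖(v : F) - Complex.I • (w : F)‖ ^ 2 := by
          rw [pol]
          refine (norm_sub_le _ _).trans (add_le_add ((norm_add_le _ _).trans
            (add_le_add ((norm_sub_le _ _).trans (add_le_add hb1 hb2)) ?_)) ?_)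
          · simpa using hb3
          · simpa using hb4
        _ = 4 * (a * (‖(v : F)‖ ^ 2 + ‖(w : F)‖ ^ 2)) := by
          linear_combination a * p1 + a * p2
    linarith
  rcases eq_or_ne ‖(v : F)‖ 0 with hv | hv
  · have : v = 0 := Subtype.ext (norm_eq_zero.1 hv)
    simp [this]
  rcases eq_or_ne ‖(w : F)‖ 0 with hw | hw
  · have : w = 0 := Subtype.ext (norm_eq_zero.1 hw)
    simp [this]
  have hvp : 0 < ‖(v : F)‖ := lt_of_le_of_ne (norm_nonneg _) hv.symm
  have hwp : 0 < ‖(w : F)‖ := lt_of_le_of_ne (norm_nonneg _) hw.symm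
  -- Normalizing both vectors turns `a (‖v‖² + ‖w‖²)` into `2a`. This is the origin of the factor 2
  -- in the theorem.
  have := step (((‖(v : F)‖⁻¹ : ℝ) : ℂ) • v) (((‖(w : F)‖⁻¹ : ℝ) : ℂ) • w)
  simp only [map_smul, inner_smul_left, inner_smul_right, norm_mul, Submodule.coe_smul, norm_smul,
    Complex.conj_ofReal, Complex.norm_real, norm_inv, norm_norm, inv_mul_cancel₀ hv,
    inv_mul_cancel₀ hw] at this
  have h2 : ‖(v : F)‖⁻¹ * (‖(w : F)‖⁻¹ * ‖inner ℂ (L (T v)) (T w)‖) * (‖(v : F)‖ * ‖(w : F)‖)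
      = ‖inner ℂ (L (T v)) (T w)‖ := by
    field_simp
  rw [← h2]
  refine mul_le_mul_of_nonneg_right ?_ (by positivity)
  linarith

end Operators

/-! ### Stone's theorem by bounded approximation -/

section Stone

variable {E : Type*} [NormedAddCommGroup E] [InnerProductSpace ℂ E] [CompleteSpace E]

/-! ### Groups generated by bounded skew-adjoint operators -/

theorem star_eq_neg_iff_inner {X : E →L[ℂ] E}
    (h : ∀ u v, inner ℂ (X u) v = -inner ℂ u (X v)) : star X = -X := by
  refine ContinuousLinearMap.ext fun v => ext_inner_left ℂ fun u => ?_
  rw [ContinuousLinearMap.star_eq_adjoint, ContinuousLinearMap.adjoint_inner_right, h,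
    neg_apply, inner_neg_right]

theorem norm_exp_smul_apply {X : E →L[ℂ] E} (hX : star X = -X) (t : ℝ) (v : E) :
    ‖NormedSpace.exp (t • X) v‖ = ‖v‖ := by
  have hs : t • X ∈ skewAdjoint (E →L[ℂ] E) := by
    rw [skewAdjoint.mem_iff, star_smul, hX, smul_neg]
    simp
  let _ : NormedAlgebra ℚ (E →L[ℂ] E) := NormedAlgebra.restrictScalars ℚ ℂ _
  have hu := NormedSpace.exp_mem_unitary_of_mem_skewAdjoint hs
  have h1 := Unitary.star_mul_self_of_mem hu
  set V := NormedSpace.exp (t • X)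
  have : inner ℂ (V v) (V v) = inner ℂ v v := by
    rw [← ContinuousLinearMap.adjoint_inner_right, ← ContinuousLinearMap.star_eq_adjoint,
      ← mul_apply_eq_comp, h1, one_apply_eq_self]
  rw [inner_self_eq_norm_sq_to_K, inner_self_eq_norm_sq_to_K] at this
  have h2 : ‖V v‖ ^ 2 = ‖v‖ ^ 2 := by exact_mod_cast this
  exact (sq_eq_sq₀ (norm_nonneg _) (norm_nonneg _)).1 h2

theorem hasDerivAt_exp_smul_apply (X : E →L[ℂ] E) (t : ℝ) (v : E) :
    HasDerivAt (fun s : ℝ => NormedSpace.exp (s • X) v) (NormedSpace.exp (t • X) (X v)) t := by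
  have h := hasDerivAt_exp_smul_const (𝕂 := ℝ) X t
  exact (((ContinuousLinearMap.apply ℂ E v).restrictScalars ℝ).hasFDerivAt.comp_hasDerivAt t h)

theorem norm_exp_smul_apply_sub_le {X : E →L[ℂ] E} (hX : star X = -X) (s t : ℝ) (v : E) :
    ‖NormedSpace.exp (t • X) v - NormedSpace.exp (s • X) v‖ ≤ ‖X v‖ * |t - s| := by
  have := Convex.norm_image_sub_le_of_norm_hasDerivWithin_le (s := (univ : Set ℝ))
    (f := fun s : ℝ => NormedSpace.exp (s • X) v) (C := ‖X v‖)
    (fun x _ => (hasDerivAt_exp_smul_apply X x v).hasDerivWithinAt)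
    (fun x _ => (norm_exp_smul_apply hX x _).le) convex_univ (mem_univ s) (mem_univ t)
  simpa using this

/-- By commutativity `exp(tX) = exp(tY) exp(t(X - Y))`. The isometry `exp(tY)` drops out, and the
orbit of `v` under the group of `X - Y` is Lipschitz with constant `‖(X - Y) v‖`. -/
theorem norm_exp_sub_exp_le {X Y : E →L[ℂ] E} (hX : star X = -X) (hY : star Y = -Y)
    (hXY : Commute X Y) (t : ℝ) (v : E) :
    ‖NormedSpace.exp (t • X) v - NormedSpace.exp (t • Y) v‖ ≤ |t| * ‖X v - Y v‖ := by
  have hc : Commute (t • Y) (t • (X - Y)) :=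
    ((hXY.symm.sub_right (Commute.refl Y)).smul_left t).smul_right t
  let _ : NormedAlgebra ℚ (E →L[ℂ] E) := NormedAlgebra.restrictScalars ℚ ℂ _
  have h1 : NormedSpace.exp (t • X) =
      NormedSpace.exp (t • Y) * NormedSpace.exp (t • (X - Y)) := by
    rw [← NormedSpace.exp_add_of_commute hc, ← smul_add, add_sub_cancel]
  have hZ : star (X - Y) = -(X - Y) := by rw [star_sub, hX, hY]; abel
  have h2 := norm_exp_smul_apply_sub_le hZ 0 t v
  rw [zero_smul, NormedSpace.exp_zero, sub_zero, one_apply_eq_self, mul_comm] at h2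
  rw [h1, mul_apply_eq_comp, ← map_sub, norm_exp_smul_apply hY]
  exact h2

/-! ### The Yosida approximation -/

variable {H : E →ₗ.[ℂ] E} (hH : IsSelfAdjoint H)

/-- The resolvent identity in vector form: with `f = (H - w) u` and `k = R(z) u`, both products
applied to `f` give `k`. -/
theorem commute_resCLM {z w : ℂ} (hz : z.im ≠ 0) (hw : w.im ≠ 0) :
    Commute (resCLM hH hz) (resCLM hH hw) := by
  refine ContinuousLinearMap.ext fun f => ?_
  simp only [mul_apply_eq_comp, resCLM_apply]
  obtain ⟨u, hu, rfl⟩ := res_spec hH hw f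
  obtain ⟨k, hk, hku⟩ := res_spec hH hz (u : E)
  have e1 : subSMul H w u = subSMul H z u + (z - w) • subSMul H z k := by
    rw [hku, subSMul_apply, subSMul_apply, sub_smul]; abel
  have e2 : res H z (subSMul H w u) = u + (z - w) • (k : E) := by
    rw [e1, ← map_smul, ← map_add, res_subSMul hH hz]; rfl
  have e3 : (u : E) + (z - w) • (k : E) = subSMul H w k := by
    rw [← hku, subSMul_apply, subSMul_apply, sub_smul]; abel
  rw [e2, e3, res_subSMul hH hw, res_subSMul hH hw, hk]

theorem im_mul_I_ne {x : ℝ} (hx : x ≠ 0) : ((x : ℂ) * Complex.I).im ≠ 0 := by simpa using hx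

/-- `-ix (H - ix)⁻¹`, an approximation of the identity for `x → ±∞`. -/
noncomputable def resApprox {x : ℝ} (hx : x ≠ 0) : E →L[ℂ] E :=
  (-((x : ℂ) * Complex.I)) • resCLM hH (im_mul_I_ne hx)

theorem norm_resApprox_apply_le {x : ℝ} (hx : x ≠ 0) (v : E) : ‖resApprox hH hx v‖ ≤ ‖v‖ := by
  have h1 := norm_res_le hH (im_mul_I_ne hx) v
  have h2 : ((x : ℂ) * Complex.I).im = x := by simp
  rw [h2] at h1
  rw [resApprox, smul_apply, norm_smul, norm_neg, norm_mul, Complex.norm_I,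
    Complex.norm_real, mul_one, Real.norm_eq_abs, resCLM_apply]
  calc |x| * ‖res H (x * Complex.I) v‖ ≤ |x| * (|x|⁻¹ * ‖v‖) := by gcongr
    _ = ‖v‖ := by rw [← mul_assoc, mul_inv_cancel₀ (abs_pos.2 hx).ne', one_mul]

theorem inner_resApprox_left {x : ℝ} (hx : x ≠ 0) (f g : E) :
    inner ℂ (resApprox hH hx f) g = inner ℂ f (resApprox hH (neg_ne_zero.2 hx) g) := by
  simp only [resApprox, smul_apply, resCLM_apply, inner_smul_left,
    inner_smul_right, inner_res_left hH (im_mul_I_ne hx)]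
  simp

theorem resApprox_mem {x : ℝ} (hx : x ≠ 0) (v : E) : resApprox hH hx v ∈ H.domain := by
  obtain ⟨u, hu, -⟩ := res_spec hH (im_mul_I_ne hx) v
  rw [resApprox, smul_apply, resCLM_apply, ← hu]
  exact H.domain.smul_mem _ u.2

/-- `H J` is the bounded operator `-ix (1 - J)`, which is how `H` enters the bounded approximation.
-/
theorem apply_resApprox {x : ℝ} (hx : x ≠ 0) (v : E) :
    H ⟨resApprox hH hx v, resApprox_mem hH hx v⟩ =
      (-((x : ℂ) * Complex.I)) • (v - resApprox hH hx v) := by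
  obtain ⟨u, hu, hv⟩ := res_spec hH (im_mul_I_ne hx) v
  have h1 : (⟨resApprox hH hx v, resApprox_mem hH hx v⟩ : H.domain) =
      (-((x : ℂ) * Complex.I)) • u := by
    ext
    rw [Submodule.coe_smul, hu]; rfl
  have h2 : resApprox hH hx v = (-((x : ℂ) * Complex.I)) • (u : E) := by rw [hu]; rfl
  rw [h1, LinearPMap.map_smul, h2, ← hv, subSMul_apply]
  congr 1
  rw [neg_smul, sub_neg_eq_add, sub_add_cancel]

theorem resApprox_apply_of_mem {x : ℝ} (hx : x ≠ 0) (u : H.domain) :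
    H ⟨resApprox hH hx u, resApprox_mem hH hx u⟩ = resApprox hH hx (H u) := by
  rw [apply_resApprox]
  have h := res_subSMul hH (im_mul_I_ne hx) u
  have h2 : resApprox hH hx (H u) =
      (-((x : ℂ) * Complex.I)) • (u : E) + ((x : ℂ) * Complex.I) • resApprox hH hx (u : E) := by
    have h3 : H u = subSMul H (x * Complex.I) u + ((x : ℂ) * Complex.I) • (u : E) := by
      rw [subSMul_apply, sub_add_cancel]
    rw [h3, map_add, map_smul]
    congr 1
    simp only [resApprox, smul_apply, resCLM_apply, h]
  rw [h2, smul_sub, neg_smul, neg_smul]; abel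

/-- On `D(H)` the error `J u - u` is at most `|x|⁻¹ ‖H u‖`, because `J` commutes with `H` there and
is a contraction. Contractivity extends the limit to the closure of `D(H)`. -/
theorem tendsto_resApprox {x : ℕ → ℝ} (hx : ∀ n, x n ≠ 0)
    (hlim : Tendsto (fun n => |x n|) atTop atTop) (v : E) :
    Tendsto (fun n => resApprox hH (hx n) v) atTop (𝓝 v) := by
  have hdom : ∀ u : H.domain, Tendsto (fun n => resApprox hH (hx n) (u : E)) atTop (𝓝 u) := by
    intro u
    rw [tendsto_iff_norm_sub_tendsto_zero]
    have hb : ∀ n, ‖resApprox hH (hx n) (u : E) - u‖ ≤ |x n|⁻¹ * ‖H u‖ := by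
      intro n
      have h1 := apply_resApprox hH (hx n) (u : E)
      rw [resApprox_apply_of_mem] at h1
      have h2 : ‖resApprox hH (hx n) (H u)‖ = |x n| * ‖resApprox hH (hx n) (u : E) - u‖ := by
        rw [h1, norm_smul, norm_sub_rev]; simp
      rw [inv_mul_eq_div, le_div_iff₀ (abs_pos.2 (hx n)), mul_comm, ← h2]
      exact norm_resApprox_apply_le hH (hx n) _
    refine squeeze_zero (fun _ => norm_nonneg _) hb ?_
    simpa using hlim.inv_tendsto_atTop.mul_const ‖H u‖
  rw [Metric.tendsto_atTop]
  intro ε hε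
  obtain ⟨y, hy, hvy⟩ := Metric.mem_closure_iff.1 (hH.dense_domain v) (ε / 3) (by positivity)
  obtain ⟨N, hN⟩ := Metric.tendsto_atTop.1 (hdom ⟨y, hy⟩) (ε / 3) (by positivity)
  refine ⟨N, fun n hn => ?_⟩
  have h1 : dist (resApprox hH (hx n) v) (resApprox hH (hx n) y) < ε / 3 := by
    rw [dist_eq_norm, ← map_sub]
    exact (norm_resApprox_apply_le hH (hx n) _).trans_lt (by rwa [← dist_eq_norm])
  calc dist (resApprox hH (hx n) v) v ≤ dist (resApprox hH (hx n) v) (resApprox hH (hx n) y)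
        + dist (resApprox hH (hx n) y) y + dist y v := dist_triangle4 _ _ _ _
    _ < ε / 3 + ε / 3 + ε / 3 := add_lt_add (add_lt_add h1 (hN n hn)) (by rwa [dist_comm])
    _ = ε := by ring

/-- The bounded skew-adjoint approximation `-i J* H J` of `-iH`, where `J = -ix (H - ix)⁻¹`. -/
noncomputable def yosida {x : ℝ} (hx : x ≠ 0) : E →L[ℂ] E :=
  (-Complex.I) • (resApprox hH (neg_ne_zero.2 hx) *
    ((-((x : ℂ) * Complex.I)) • (1 - resApprox hH hx)))

theorem yosida_apply {x : ℝ} (hx : x ≠ 0) (v : E) :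
    yosida hH hx v = (-Complex.I) • resApprox hH (neg_ne_zero.2 hx)
      (H ⟨resApprox hH hx v, resApprox_mem hH hx v⟩) := by
  rw [apply_resApprox]; rfl

/-- The sandwiched form `J* H J`, with `J*` obtained by changing the sign of `x`, makes this a
direct consequence of the symmetry of `H`. -/
theorem star_yosida {x : ℝ} (hx : x ≠ 0) : star (yosida hH hx) = -yosida hH hx := by
  refine star_eq_neg_iff_inner fun u v => ?_
  have h : ∀ w, inner ℂ (resApprox hH (neg_ne_zero.2 hx) w) v = inner ℂ w (resApprox hH hx v) := by
    intro w
    rw [inner_resApprox_left]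
    simp only [neg_neg]
  rw [yosida_apply, yosida_apply, inner_smul_left, inner_smul_right, h,
    ← inner_resApprox_left hH hx,
    inner_symm_of_isSelfAdjoint hH ⟨_, resApprox_mem hH hx u⟩ ⟨_, resApprox_mem hH hx v⟩]
  simp

theorem commute_yosida {x y : ℝ} (hx : x ≠ 0) (hy : y ≠ 0) :
    Commute (yosida hH hx) (yosida hH hy) := by
  have hc : ∀ {x y : ℝ} (hx : x ≠ 0) (hy : y ≠ 0),
      Commute (resApprox hH hx) (resApprox hH hy) := fun hx hy =>
    ((commute_resCLM hH (im_mul_I_ne hx) (im_mul_I_ne hy)).smul_left _).smul_right _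
  have hc1 : ∀ {x y : ℝ} (hx : x ≠ 0) (hy : y ≠ 0),
      Commute (resApprox hH hx) (1 - resApprox hH hy) := fun hx hy =>
    (Commute.one_right _).sub_right (hc hx hy)
  have hc2 : Commute (1 - resApprox hH hx) (1 - resApprox hH hy) :=
    (Commute.one_left _).sub_left (hc1 hx hy)
  refine Commute.smul_left (Commute.smul_right (Commute.mul_left (Commute.mul_right (hc _ _) ?_)
    (Commute.mul_right ?_ ?_)) _) _
  · exact (hc1 _ _).smul_right _
  · exact ((hc1 _ _).symm).smul_left _
  · exact (hc2.smul_left _).smul_right _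

theorem tendsto_yosida {x : ℕ → ℝ} (hx : ∀ n, x n ≠ 0)
    (hlim : Tendsto (fun n => |x n|) atTop atTop) (u : H.domain) :
    Tendsto (fun n => yosida hH (hx n) (u : E)) atTop (𝓝 (-(Complex.I • H u))) := by
  rw [← neg_smul]
  simp only [yosida_apply, resApprox_apply_of_mem]
  refine Tendsto.const_smul ?_ _
  have h1 := tendsto_resApprox hH hx hlim (H u)
  have h2 := tendsto_resApprox hH (fun n => neg_ne_zero.2 (hx n)) (by simpa using hlim) (H u)
  rw [tendsto_iff_norm_sub_tendsto_zero] at h1 h2 ⊢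
  refine squeeze_zero (fun _ => norm_nonneg _) (fun n => ?_) (by simpa using h1.add h2)
  calc ‖resApprox hH (neg_ne_zero.2 (hx n)) (resApprox hH (hx n) (H u)) - H u‖
      = ‖resApprox hH (neg_ne_zero.2 (hx n)) (resApprox hH (hx n) (H u) - H u)
        + (resApprox hH (neg_ne_zero.2 (hx n)) (H u) - H u)‖ := by
        rw [map_sub, sub_add_sub_cancel]
    _ ≤ _ := (norm_add_le _ _).trans (add_le_add (norm_resApprox_apply_le hH _ _) le_rfl)

/-! ### Stone's theorem -/

/-- The approximating groups. -/
noncomputable def approxGroup (n : ℕ) (t : ℝ) : E →L[ℂ] E :=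
  NormedSpace.exp (t • yosida hH (x := (n : ℝ) + 1) (by positivity))

theorem norm_approxGroup (n : ℕ) (t : ℝ) (v : E) : ‖approxGroup hH n t v‖ = ‖v‖ :=
  norm_exp_smul_apply (star_yosida hH _) t v

theorem tendsto_yosida_nat (u : H.domain) :
    Tendsto (fun n : ℕ => yosida hH (x := (n : ℝ) + 1) (by positivity) (u : E)) atTop
      (𝓝 (-(Complex.I • H u))) := by
  refine tendsto_yosida hH (x := fun n : ℕ => (n : ℝ) + 1) (fun n => by positivity) ?_ u
  refine (tendsto_atTop_add_const_right _ (1 : ℝ) tendsto_natCast_atTop_atTop).congr fun n => ?_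
  rw [abs_of_nonneg (by positivity)]

/-- On `D(H)` the generators converge strongly and commute, so `norm_exp_sub_exp_le` makes the
groups Cauchy. Isometry carries this to all of `E`. -/
theorem cauchySeq_approxGroup (t : ℝ) (v : E) : CauchySeq fun n => approxGroup hH n t v := by
  have hdom : ∀ u : H.domain, CauchySeq fun n => approxGroup hH n t (u : E) := by
    intro u
    have hc := (tendsto_yosida_nat hH u).cauchySeq
    rw [Metric.cauchySeq_iff] at hc ⊢
    intro ε hε
    obtain ⟨N, hN⟩ := hc (ε / (|t| + 1)) (by positivity)
    refine ⟨N, fun m hm n hn => ?_⟩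
    have h1 := hN m hm n hn
    rw [dist_eq_norm, lt_div_iff₀ (by positivity)] at h1
    rw [dist_eq_norm]
    refine (norm_exp_sub_exp_le (star_yosida hH _) (star_yosida hH _)
      (commute_yosida hH _ _) t _).trans_lt (lt_of_le_of_lt ?_ h1)
    rw [mul_comm]
    gcongr
    linarith
  rw [Metric.cauchySeq_iff]
  intro ε hε
  obtain ⟨y, hy, hvy⟩ := Metric.mem_closure_iff.1 (hH.dense_domain v) (ε / 3) (by positivity)
  obtain ⟨N, hN⟩ := Metric.cauchySeq_iff.1 (hdom ⟨y, hy⟩) (ε / 3) (by positivity)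
  have hb : ∀ n, dist (approxGroup hH n t v) (approxGroup hH n t y) < ε / 3 := fun n => by
    rwa [dist_eq_norm, ← map_sub, norm_approxGroup, ← dist_eq_norm]
  refine ⟨N, fun m hm n hn => ?_⟩
  calc dist (approxGroup hH m t v) (approxGroup hH n t v)
      ≤ dist (approxGroup hH m t v) (approxGroup hH m t y)
        + dist (approxGroup hH m t y) (approxGroup hH n t y)
        + dist (approxGroup hH n t y) (approxGroup hH n t v) := dist_triangle4 _ _ _ _
    _ < ε / 3 + ε / 3 + ε / 3 := add_lt_add (add_lt_add (hb m) (hN m hm n hn))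
        (by rw [dist_comm]; exact hb n)
    _ = ε := by ring

theorem tendsto_approxGroup_lim (t : ℝ) (v : E) :
    Tendsto (fun n => approxGroup hH n t v) atTop
      (𝓝 (limUnder atTop fun n => approxGroup hH n t v)) :=
  tendsto_nhds_limUnder (cauchySeq_tendsto_of_complete (cauchySeq_approxGroup hH t v))

/-- The unitary group generated by `-iH`, as the limit of the approximating groups. -/
noncomputable def stoneGroup (t : ℝ) : E →L[ℂ] E :=
  LinearMap.mkContinuous
    { toFun := fun v => limUnder atTop fun n => approxGroup hH n t v
      map_add' := fun v w => tendsto_nhds_unique (tendsto_approxGroup_lim hH t (v + w)) <| by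
        simpa only [map_add] using
          (tendsto_approxGroup_lim hH t v).add (tendsto_approxGroup_lim hH t w)
      map_smul' := fun c v => tendsto_nhds_unique (tendsto_approxGroup_lim hH t (c • v)) <| by
        simpa only [map_smul, RingHom.id_apply] using
          (tendsto_approxGroup_lim hH t v).const_smul c }
    1 fun v => by
      rw [one_mul]
      exact le_of_tendsto (tendsto_approxGroup_lim hH t v).norm
        (Eventually.of_forall fun n => (norm_approxGroup hH n t v).le)

theorem tendsto_approxGroup (t : ℝ) (v : E) :
    Tendsto (fun n => approxGroup hH n t v) atTop (𝓝 (stoneGroup hH t v)) :=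
  tendsto_approxGroup_lim hH t v

theorem norm_stoneGroup (t : ℝ) (v : E) : ‖stoneGroup hH t v‖ = ‖v‖ :=
  tendsto_nhds_unique (tendsto_approxGroup hH t v).norm <|
    tendsto_const_nhds.congr fun n => (norm_approxGroup hH n t v).symm

theorem stoneGroup_zero : stoneGroup hH 0 = 1 :=
  ContinuousLinearMap.ext fun v => tendsto_nhds_unique (tendsto_approxGroup hH 0 v) <|
    tendsto_const_nhds.congr fun n => by
      rw [approxGroup, zero_smul, NormedSpace.exp_zero]

theorem stoneGroup_add (s t : ℝ) : stoneGroup hH (s + t) = stoneGroup hH s * stoneGroup hH t := by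
  refine ContinuousLinearMap.ext fun v =>
    tendsto_nhds_unique (tendsto_approxGroup hH (s + t) v) ?_
  have h1 := tendsto_approxGroup hH t v
  have h2 := tendsto_approxGroup hH s (stoneGroup hH t v)
  rw [tendsto_iff_norm_sub_tendsto_zero] at h1 h2 ⊢
  refine squeeze_zero (fun _ => norm_nonneg _) (fun n => ?_) (by simpa using h1.add h2)
  have h3 : approxGroup hH n (s + t) v = approxGroup hH n s (approxGroup hH n t v) := by
    let _ : NormedAlgebra ℚ (E →L[ℂ] E) := NormedAlgebra.restrictScalars ℚ ℂ _
    rw [approxGroup, add_smul, NormedSpace.exp_add_of_commute]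
    · rfl
    · exact ((Commute.refl _).smul_left s).smul_right t
  calc ‖approxGroup hH n (s + t) v - (stoneGroup hH s * stoneGroup hH t) v‖
      = ‖approxGroup hH n s (approxGroup hH n t v - stoneGroup hH t v)
        + (approxGroup hH n s (stoneGroup hH t v) - stoneGroup hH s (stoneGroup hH t v))‖ := by
        rw [h3, map_sub, sub_add_sub_cancel]; rfl
    _ ≤ _ := (norm_add_le _ _).trans_eq (by rw [norm_approxGroup])

theorem continuous_stoneGroup (v : E) : Continuous fun t => stoneGroup hH t v := by
  have hdom : ∀ u : H.domain, Continuous fun t => stoneGroup hH t (u : E) := by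
    intro u
    refine (LipschitzWith.of_dist_le_mul (K := ‖H u‖₊) fun s t => ?_).continuous
    rw [dist_eq_norm, dist_eq_norm, coe_nnnorm]
    have h1 : ‖-(Complex.I • H u)‖ = ‖H u‖ := by rw [norm_neg, norm_smul]; simp
    rw [← h1]
    exact le_of_tendsto_of_tendsto
      ((tendsto_approxGroup hH s (u : E)).sub (tendsto_approxGroup hH t (u : E))).norm
      ((tendsto_yosida_nat hH u).norm.mul_const _)
      (Eventually.of_forall fun n => norm_exp_smul_apply_sub_le (star_yosida hH _) t s _)
  obtain ⟨y, hy, hlim⟩ := mem_closure_iff_seq_limit.1 (hH.dense_domain v)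
  have hunif : TendstoUniformly (fun n t => stoneGroup hH t (y n)) (fun t => stoneGroup hH t v)
      atTop := by
    rw [Metric.tendstoUniformly_iff]
    intro ε hε
    filter_upwards [Metric.tendsto_nhds.1 hlim ε hε] with n hn t
    rw [dist_eq_norm, ← map_sub, norm_stoneGroup, ← dist_eq_norm, dist_comm]
    exact hn
  exact hunif.continuous (Eventually.of_forall fun n => hdom ⟨y n, hy n⟩).frequently

/-- The fundamental theorem of calculus for the approximating groups, passed to the limit by
dominated convergence. It provides the derivative of the orbits of `D(H)` at `0`. -/
theorem stoneGroup_sub_eq_integral (u : H.domain) (t : ℝ) :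
    stoneGroup hH t (u : E) - u = ∫ s in (0 : ℝ)..t, stoneGroup hH s (-(Complex.I • H u)) := by
  have hcont : ∀ n (v : E), Continuous fun s => approxGroup hH n s v := fun n v =>
    continuous_iff_continuousAt.2 fun s => (hasDerivAt_exp_smul_apply _ s v).continuousAt
  have hn : ∀ n : ℕ, approxGroup hH n t (u : E) - u =
      ∫ s in (0 : ℝ)..t, approxGroup hH n s (yosida hH (x := (n : ℝ) + 1) (by positivity) u) := by
    intro n
    have h1 := intervalIntegral.integral_eq_sub_of_hasDerivAt (a := 0) (b := t)
      (f := fun s => approxGroup hH n s (u : E))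
      (fun s _ => hasDerivAt_exp_smul_apply _ s _) ((hcont n _).intervalIntegrable _ _)
    refine Eq.trans ?_ h1.symm
    congr 1
    rw [approxGroup, zero_smul, NormedSpace.exp_zero]; rfl
  have hy := tendsto_yosida_nat hH u
  refine tendsto_nhds_unique ((tendsto_approxGroup hH t (u : E)).sub_const _) ?_
  simp_rw [hn]
  generalize -(Complex.I • H u) = g at hy ⊢
  obtain ⟨M, hM⟩ := hy.norm.bddAbove_range
  refine intervalIntegral.tendsto_integral_filter_of_dominated_convergence (fun _ => M)
    (Eventually.of_forall fun n => (hcont n _).aestronglyMeasurable)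
    (Eventually.of_forall fun n => Eventually.of_forall fun s _ => ?_)
    intervalIntegrable_const (Eventually.of_forall fun s _ => ?_)
  · rw [norm_approxGroup]
    exact hM ⟨n, rfl⟩
  · have h2 := tendsto_approxGroup hH s g
    rw [tendsto_iff_norm_sub_tendsto_zero] at h2 hy ⊢
    refine squeeze_zero (fun _ => norm_nonneg _) (fun n => ?_) (by simpa using hy.add h2)
    rw [← norm_approxGroup hH n s (_ - g), map_sub]
    refine le_trans (le_of_eq ?_) (norm_add_le _ _)
    rw [sub_add_sub_cancel]

end Stone

/-! ### The unitary group and its Laplace transform -/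

section UnitaryGroup

variable {E : Type*} [NormedAddCommGroup E] [InnerProductSpace ℂ E] [CompleteSpace E]

/-- For a group of isometries, `⟪U(t) v, w⟫ = ⟪v, U(-t) w⟫`. -/
theorem inner_group_left {U : ℝ → E →L[ℂ] E} (h0 : U 0 = 1) (hadd : ∀ s t, U (s + t) = U s * U t)
    (hn : ∀ t v, ‖U t v‖ = ‖v‖) (t : ℝ) (v w : E) :
    inner ℂ (U t v) w = inner ℂ v (U (-t) w) := by
  have h1 : U t (U (-t) w) = w := by
    rw [← mul_apply_eq_comp, ← hadd, add_neg_cancel, h0, one_apply_eq_self]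
  conv_lhs => rw [← h1]
  exact LinearIsometry.inner_map_map ⟨(U t).toLinearMap, hn t⟩ v (U (-t) w)

theorem isUnitaryGroup_stoneGroup {H : E →ₗ.[ℂ] E} (hH : IsSelfAdjoint H) :
    IsUnitaryGroup H (stoneGroup hH) where
  zero := stoneGroup_zero hH
  add := stoneGroup_add hH
  norm_map := norm_stoneGroup hH
  continuous := continuous_stoneGroup hH
  generator := by
    have hderiv : ∀ u : H.domain,
        HasDerivAt (fun t => stoneGroup hH t (u : E)) (-(Complex.I • H u)) 0 := by
      intro u
      have h := (continuous_stoneGroup hH (-(Complex.I • H u))).integral_hasStrictDerivAt 0 0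
      have h2 := h.hasDerivAt.add_const (u : E)
      rw [stoneGroup_zero, one_apply_eq_self] at h2
      refine h2.congr_of_eventuallyEq (Eventually.of_forall fun t => ?_)
      exact sub_eq_iff_eq_add.1 (stoneGroup_sub_eq_integral hH u t)
    intro v w
    constructor
    · intro h
      -- The generator is no larger than `-iH`: differentiating `⟪U(t) v, u⟫ = ⟪v, U(-t) u⟫` at `0`
      -- shows `v ∈ D(H*)`, which is `D(H)`.
      have key : ∀ u : H.domain, inner ℂ (Complex.I • w) (u : E) = inner ℂ v (H u) := by
        intro u
        have e1 : HasDerivAt (fun t => inner ℂ (stoneGroup hH t v) (u : E)) (inner ℂ w (u : E))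
            0 := by
          simpa using h.inner ℂ (hasDerivAt_const (0 : ℝ) (u : E))
        have hd : HasDerivAt (fun t : ℝ => stoneGroup hH (-t) (u : E)) (Complex.I • H u) 0 := by
          have := (hderiv u).scomp_of_eq (0 : ℝ) (hasDerivAt_neg (0 : ℝ)) (by simp)
          simpa [Function.comp_def] using this
        have e2 : HasDerivAt (fun t => inner ℂ v (stoneGroup hH (-t) (u : E)))
            (inner ℂ v (Complex.I • H u)) 0 := by
          simpa [inner_smul_right] using (hasDerivAt_const (0 : ℝ) v).inner ℂ hd
        have e3 : inner ℂ w (u : E) = inner ℂ v (Complex.I • H u) :=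
          e1.unique (e2.congr_of_eventuallyEq (Eventually.of_forall fun t =>
            inner_group_left (stoneGroup_zero hH) (stoneGroup_add hH) (norm_stoneGroup hH) t v u))
        rw [inner_smul_left, e3, inner_smul_right, Complex.conj_I, ← mul_assoc, neg_mul,
          Complex.I_mul_I, neg_neg, one_mul]
      obtain ⟨hv, hHv⟩ := mem_domain_of_isSelfAdjoint hH key
      refine ⟨hv, ?_⟩
      rw [hHv, smul_smul, Complex.I_mul_I, neg_smul, one_smul, neg_neg]
    · rintro ⟨hv, rfl⟩
      exact hderiv ⟨v, hv⟩

theorem isUnitaryGroup_propagator {H : E →ₗ.[ℂ] E} (hH : IsSelfAdjoint H) :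
    IsUnitaryGroup H (propagator H) := by
  have h : ∃ U, IsUnitaryGroup H U := ⟨_, isUnitaryGroup_stoneGroup hH⟩
  rw [propagator, dif_pos h]
  exact h.choose_spec

theorem IsUnitaryGroup.hasDerivAt {H : E →ₗ.[ℂ] E} {U : ℝ → E →L[ℂ] E} (hU : IsUnitaryGroup H U)
    (u : H.domain) (t : ℝ) :
    HasDerivAt (fun s => U s (u : E)) (U t (-(Complex.I • H u))) t := by
  have h0 := (hU.generator u _).2 ⟨u.2, rfl⟩
  have h1 : HasDerivAt (fun s => U t (U (s - t) (u : E))) (U t (-(Complex.I • H u))) t := by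
    have h2 : HasDerivAt (fun s => U (s - t) (u : E)) (-(Complex.I • H u)) t :=
      HasDerivAt.comp_sub_const t t (by simpa using h0)
    exact ((U t).restrictScalars ℝ).hasFDerivAt.comp_hasDerivAt t h2
  refine h1.congr_of_eventuallyEq (Eventually.of_forall fun s => ?_)
  simp only
  rw [← mul_apply_eq_comp, ← hU.add, add_sub_cancel]

theorem IsUnitaryGroup.mem_domain {H : E →ₗ.[ℂ] E} {U : ℝ → E →L[ℂ] E} (hU : IsUnitaryGroup H U)
    (u : H.domain) (t : ℝ) : ∃ h : U t u ∈ H.domain, H ⟨U t u, h⟩ = U t (H u) := by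
  have h0 := (hU.generator u _).2 ⟨u.2, rfl⟩
  have h1 : HasDerivAt (fun s => U s (U t (u : E))) (U t (-(Complex.I • H u))) 0 := by
    refine (((U t).restrictScalars ℝ).hasFDerivAt.comp_hasDerivAt 0 h0).congr_of_eventuallyEq
      (Eventually.of_forall fun s => ?_)
    simp only [ContinuousLinearMap.coe_restrictScalars', Function.comp_apply]
    rw [← mul_apply_eq_comp, ← mul_apply_eq_comp, ← hU.add, ← hU.add,
      add_comm]
  obtain ⟨h2, h3⟩ := (hU.generator _ _).1 h1
  refine ⟨h2, ?_⟩
  rw [map_neg, map_smul, neg_inj] at h3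
  exact (smul_right_injective E Complex.I_ne_zero h3).symm

theorem IsUnitaryGroup.res_apply {H : E →ₗ.[ℂ] E} (hH : IsSelfAdjoint H) {U : ℝ → E →L[ℂ] E}
    (hU : IsUnitaryGroup H U) {z : ℂ} (hz : z.im ≠ 0) (t : ℝ) (f : E) :
    U t (res H z f) = res H z (U t f) := by
  obtain ⟨u, hu, rfl⟩ := res_spec hH hz f
  obtain ⟨h1, h2⟩ := hU.mem_domain u t
  have h3 : U t (subSMul H z u) = subSMul H z ⟨U t u, h1⟩ := by
    rw [subSMul_apply, subSMul_apply, h2, map_sub, map_smul]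
  rw [h3, res_subSMul hH hz, res_subSMul hH hz]

open Complex in
/-- The resolvent is a Laplace transform of the propagator. -/
theorem IsUnitaryGroup.integral_Ioi {H : E →ₗ.[ℂ] E} (hH : IsSelfAdjoint H) {U : ℝ → E →L[ℂ] E}
    (hU : IsUnitaryGroup H U) {σ : ℝ} (hσ : σ ^ 2 = 1) {z : ℂ} (hz : 0 < σ * z.im) (f : E) :
    IntegrableOn (fun τ : ℝ => cexp (I * σ * z * τ) • U (σ * τ) f) (Ioi 0) ∧
    ∫ τ in Ioi (0 : ℝ), cexp (I * σ * z * τ) • U (σ * τ) f = (-(I * σ)) • res H z f := by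
  have hz' : z.im ≠ 0 := fun h => by simp [h] at hz
  have hσ' : (σ : ℂ) ^ 2 = 1 := by exact_mod_cast hσ
  have hnorm : ∀ (g : E) (τ : ℝ), ‖cexp (I * σ * z * τ) • U (σ * τ) g‖ =
      Real.exp (-(σ * z.im) * τ) * ‖g‖ := by
    intro g τ
    rw [norm_smul, hU.norm_map, Complex.norm_exp]
    congr 2
    simp [Complex.mul_re, Complex.mul_im]
  have hcont : ∀ g : E, Continuous fun τ : ℝ => cexp (I * σ * z * τ) • U (σ * τ) g := fun g =>
    (by fun_prop : Continuous fun τ : ℝ => cexp (I * σ * z * τ)).smul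
      ((hU.continuous g).comp (continuous_const.mul continuous_id))
  have hint : ∀ g : E, IntegrableOn (fun τ : ℝ => cexp (I * σ * z * τ) • U (σ * τ) g) (Ioi 0) := by
    intro g
    refine Integrable.mono' ((exp_neg_integrableOn_Ioi 0 hz).mul_const ‖g‖)
      (hcont g).aestronglyMeasurable (Eventually.of_forall fun τ => ?_)
    rw [hnorm]
  refine ⟨hint f, ?_⟩
  obtain ⟨u, hu, rfl⟩ := res_spec hH hz' f
  -- For `f = (H - z) u` the integrand is, up to the factor `-iσ`, an exact derivative. The
  -- condition `σ Im z > 0` makes the boundary term at infinity vanish.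
  have hderiv : ∀ τ : ℝ, HasDerivAt (fun τ : ℝ => cexp (I * σ * z * τ) • U (σ * τ) (u : E))
      ((-(I * σ)) • cexp (I * σ * z * τ) • U (σ * τ) (subSMul H z u)) τ := by
    intro τ
    have h1 : HasDerivAt (fun τ : ℝ => cexp (I * σ * z * τ))
        (cexp (I * σ * z * τ) * (I * σ * z)) τ := by
      have h3 : HasDerivAt (fun τ : ℝ => I * σ * z * (τ : ℂ)) (I * σ * z) τ := by
        simpa using (Complex.ofRealCLM.hasDerivAt (x := τ)).const_mul (I * σ * z)
      exact h3.cexp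
    have h2 : HasDerivAt (fun τ : ℝ => U (σ * τ) (u : E))
        (σ • U (σ * τ) (-(Complex.I • H u))) τ := by
      have h3 : HasDerivAt (fun τ : ℝ => σ * τ) σ τ := by
        simpa using (hasDerivAt_id τ).const_mul σ
      exact (hU.hasDerivAt u (σ * τ)).scomp τ h3
    have h4 := h1.smul h2
    refine HasDerivAt.congr_deriv h4 ?_
    rw [subSMul_apply, map_sub, map_smul, map_neg, map_smul, ← Complex.coe_smul]
    module
  have hlim : Tendsto (fun τ : ℝ => cexp (I * σ * z * τ) • U (σ * τ) (u : E)) atTop (𝓝 0) := by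
    rw [tendsto_zero_iff_norm_tendsto_zero]
    simp_rw [hnorm]
    have : Tendsto (fun τ : ℝ => Real.exp (-(σ * z.im) * τ)) atTop (𝓝 0) :=
      Real.tendsto_exp_atBot.comp (tendsto_id.const_mul_atTop_of_neg (neg_neg_of_pos hz))
    simpa using this.mul_const ‖(u : E)‖
  have hftc := integral_Ioi_of_hasDerivAt_of_tendsto (hcont _).continuousWithinAt
    (fun τ _ => hderiv τ) ((hint (subSMul H z u)).smul (-(I * σ))) hlim
  rw [integral_smul] at hftc
  rw [← hu]
  have h5 : (I * σ) • (-(I * σ)) • ∫ τ in Ioi (0 : ℝ), cexp (I * σ * z * τ) •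
      U (σ * τ) (subSMul H z u) = ∫ τ in Ioi (0 : ℝ), cexp (I * σ * z * τ) •
      U (σ * τ) (subSMul H z u) := by
    rw [smul_smul]
    have : (I * σ) * (-(I * σ)) = 1 := by
      linear_combination (-(σ : ℂ) ^ 2) * Complex.I_sq + hσ'
    rw [this, one_smul]
  rw [← h5, hftc]
  simp [hU.zero]

end UnitaryGroup

/-! ### Plancherel for Hilbert-space-valued functions -/

section Plancherel

open FourierTransform SchwartzMap

variable {G : Type*} [NormedAddCommGroup G] [InnerProductSpace ℂ G] [CompleteSpace G]

theorem memLp_two_of_integrable_of_bound {α : Type*} [MeasurableSpace α] {μ : Measure α}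
    {G : Type*} [NormedAddCommGroup G] {f : α → G}
    (hf : Integrable f μ) {M : ℝ} (hM : ∀ x, ‖f x‖ ≤ M) : MemLp f 2 μ := by
  rw [memLp_two_iff_integrable_sq_norm hf.1]
  refine (hf.norm.const_mul M).mono' (hf.1.norm.pow 2) (Eventually.of_forall fun x => ?_)
  rw [Real.norm_of_nonneg (sq_nonneg _), sq]
  exact mul_le_mul_of_nonneg_right (hM x) (norm_nonneg _)

/-- On `L¹ ∩ L²` the Fourier transform on `L²` is given by the Fourier integral. -/
theorem coeFn_fourier_toLp {f : ℝ → G} (hf : Integrable f) (hf2 : MemLp f 2) :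
    (𝓕 (hf2.toLp f) : Lp G 2 (volume : Measure ℝ)) =ᵐ[volume] 𝓕 f := by
  set g : Lp G 2 (volume : Measure ℝ) := 𝓕 (hf2.toLp f) with hg
  have hcont : Continuous (𝓕 f) :=
    VectorFourier.fourierIntegral_continuous Real.continuous_fourierChar
      continuous_inner hf
  have hloc : LocallyIntegrable (fun x => g x - 𝓕 f x) volume :=
    ((Lp.memLp g).locallyIntegrable (by norm_num)).sub hcont.locallyIntegrable
  -- Both transforms are compared as distributions: the definition of the `L²` transform and Fubini
  -- each move `𝓕` onto the test function.
  have key : ∀ φ : ℝ → ℝ, ContDiff ℝ (↑(⊤ : ℕ∞)) φ → HasCompactSupport φ →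
      ∫ x, φ x • (g x - 𝓕 f x) = 0 := by
    intro φ hφ hφc
    have hc : HasCompactSupport (fun x => (φ x : ℂ)) := hφc.comp_left (g := ((↑) : ℝ → ℂ)) rfl
    let Φ : 𝓢(ℝ, ℂ) := hc.toSchwartzMap (Complex.ofRealCLM.contDiff.comp hφ)
    have hΦ : ∀ x, Φ x = (φ x : ℂ) := fun x => rfl
    have h1 := congrArg (fun T : 𝓢'(ℝ, G) => T Φ)
      (Lp.fourier_toTemperedDistribution_eq (hf2.toLp f))
    simp only [TemperedDistribution.fourier_apply, Lp.toTemperedDistribution_apply] at h1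
    have h2 : ∫ x, (𝓕 Φ) x • (hf2.toLp f) x = ∫ x, (𝓕 Φ) x • f x :=
      integral_congr_ae (by filter_upwards [hf2.coeFn_toLp] with x hx; rw [hx])
    have h3 : ∫ x, (𝓕 Φ) x • f x = ∫ x, Φ x • (𝓕 f) x := by
      have := VectorFourier.integral_fourierIntegral_smul_eq_flip (L := innerₗ ℝ)
        Real.continuous_fourierChar continuous_inner (Φ.integrable (μ := volume)) hf
      rw [flip_innerₗ] at this
      rw [SchwartzMap.fourier_coe]
      exact this
    rw [h2, h3] at h1
    have hi1 : Integrable fun x => φ x • g x :=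
      ((Lp.memLp g).locallyIntegrable (by norm_num)).integrable_smul_left_of_hasCompactSupport
        hφ.continuous hφc
    have hi2 : Integrable fun x => φ x • 𝓕 f x :=
      hcont.locallyIntegrable.integrable_smul_left_of_hasCompactSupport hφ.continuous hφc
    simp_rw [smul_sub]
    rw [integral_sub hi1 hi2, sub_eq_zero]
    simp only [hΦ, Complex.coe_smul] at h1
    exact h1.symm
  filter_upwards [ae_eq_zero_of_integral_contDiff_smul_eq_zero hloc key] with x hx
  exact sub_eq_zero.1 hx

theorem integral_inner_fourier {f g : ℝ → G} (hf : Integrable f) (hf2 : MemLp f 2)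
    (hg : Integrable g) (hg2 : MemLp g 2) :
    ∫ x, inner ℂ (f x) (g x) = ∫ ξ, inner ℂ (𝓕 f ξ) (𝓕 g ξ) := by
  have h := Lp.inner_fourier_eq (hf2.toLp f) (hg2.toLp g)
  rw [L2.inner_def, L2.inner_def] at h
  rw [integral_congr_ae (g := fun ξ => inner ℂ (𝓕 f ξ) (𝓕 g ξ))] at h
  · rw [h]
    refine integral_congr_ae ?_
    filter_upwards [hf2.coeFn_toLp, hg2.coeFn_toLp] with x h1 h2
    rw [h1, h2]
  · filter_upwards [coeFn_fourier_toLp hf hf2, coeFn_fourier_toLp hg hg2] with x h1 h2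
    rw [h1, h2]

theorem memLp_fourier {f : ℝ → G} (hf : Integrable f) (hf2 : MemLp f 2) : MemLp (𝓕 f) 2 :=
  (memLp_congr_ae (coeFn_fourier_toLp hf hf2)).1 (Lp.memLp _)

theorem eLpNorm_fourier {f : ℝ → G} (hf : Integrable f) (hf2 : MemLp f 2) :
    (eLpNorm (𝓕 f) 2 volume).toReal = (eLpNorm f 2 volume).toReal := by
  rw [← eLpNorm_congr_ae (coeFn_fourier_toLp hf hf2), ← Lp.norm_def, Lp.norm_fourier_eq,
    Lp.norm_toLp]

theorem integral_norm_mul_norm_le {α G₁ G₂ : Type*} [MeasurableSpace α] {μ : Measure α}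
    [NormedAddCommGroup G₁] [NormedAddCommGroup G₂] {f : α → G₁} {g : α → G₂} (hf : MemLp f 2 μ)
    (hg : MemLp g 2 μ) :
    Integrable (fun x => ‖f x‖ * ‖g x‖) μ ∧
    ∫ x, ‖f x‖ * ‖g x‖ ∂μ ≤ (eLpNorm f 2 μ).toReal * (eLpNorm g 2 μ).toReal := by
  refine ⟨hf.norm.integrable_mul hg.norm, ?_⟩
  have h := real_inner_le_norm (hf.norm.toLp _) (hg.norm.toLp _)
  rw [L2.inner_def, Lp.norm_toLp, Lp.norm_toLp, eLpNorm_norm, eLpNorm_norm] at h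
  refine le_trans (le_of_eq (integral_congr_ae ?_)) h
  filter_upwards [hf.norm.coeFn_toLp, hg.norm.coeFn_toLp] with x h1 h2
  rw [h1, h2]
  simp [mul_comm]

theorem norm_integral_inner_le {α : Type*} [MeasurableSpace α] {μ : Measure α}
    {f g : α → G} (hf : MemLp f 2 μ) (hg : MemLp g 2 μ) :
    ‖∫ x, inner ℂ (f x) (g x) ∂μ‖ ≤ (eLpNorm f 2 μ).toReal * (eLpNorm g 2 μ).toReal := by
  obtain ⟨h1, h2⟩ := integral_norm_mul_norm_le hf hg
  exact (norm_integral_le_of_norm_le h1 (Eventually.of_forall fun x =>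
    norm_inner_le_norm _ _)).trans h2

end Plancherel

/-! ### Causal convolution as a Fourier multiplier -/

section Multiplier

open FourierTransform Complex

variable {E F : Type*} [NormedAddCommGroup E] [InnerProductSpace ℂ E] [CompleteSpace E]
  [NormedAddCommGroup F] [InnerProductSpace ℂ F] [CompleteSpace F] {D : Submodule ℂ F}

/-- A finite combination of vectors with bounded integrable scalar coefficients. -/
def IsTame (h : ℝ → D) : Prop :=
  ∃ (s : Finset D) (φ : D → ℝ → ℂ),
    (∀ i ∈ s, Integrable (φ i) ∧ ∃ M, ∀ t, ‖φ i t‖ ≤ M) ∧ ∀ t, h t = ∑ i ∈ s, φ i t • i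

theorem IsTame.integrable {h : ℝ → D} (hh : IsTame h) {G : Type*} [NormedAddCommGroup G]
    [NormedSpace ℂ G] (S : D →ₗ[ℂ] G) : Integrable fun t => S (h t) := by
  obtain ⟨s, φ, hφ, hs⟩ := hh
  simp_rw [hs, map_sum, map_smul]
  exact integrable_finsetSum _ fun i hi => (hφ i hi).1.smul_const _

theorem IsTame.bounded {h : ℝ → D} (hh : IsTame h) {G : Type*} [NormedAddCommGroup G]
    [NormedSpace ℂ G] (S : D →ₗ[ℂ] G) : ∃ M, ∀ t, ‖S (h t)‖ ≤ M := by
  obtain ⟨s, φ, hφ, hs⟩ := hh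
  have : ∀ i, ∃ M, i ∈ s → ∀ t, ‖φ i t‖ ≤ M := fun i => by
    by_cases hi : i ∈ s
    · obtain ⟨M, hM⟩ := (hφ i hi).2
      exact ⟨M, fun _ => hM⟩
    · exact ⟨0, fun h => absurd h hi⟩
  choose M hM using this
  refine ⟨∑ i ∈ s, M i * ‖S i‖, fun t => ?_⟩
  simp_rw [hs, map_sum, map_smul]
  refine norm_sum_le_of_le _ fun i hi => ?_
  rw [norm_smul]
  exact mul_le_mul_of_nonneg_right (hM i hi t) (norm_nonneg _)

theorem IsTame.memLp {h : ℝ → D} (hh : IsTame h) {G : Type*} [NormedAddCommGroup G]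
    [NormedSpace ℂ G] (S : D →ₗ[ℂ] G) : MemLp (fun t => S (h t)) 2 := by
  obtain ⟨M, hM⟩ := hh.bounded S
  exact memLp_two_of_integrable_of_bound (hh.integrable S) hM

/-- `S` may be unbounded, so it need not commute with general integrals. For finite combinations it
does, and the transform stays `D`-valued, so the symbol bound on `D` can be applied at each
frequency. -/
theorem fourier_finsetSum {G : Type*} [NormedAddCommGroup G] [InnerProductSpace ℂ G]
    [CompleteSpace G] (S : D →ₗ[ℂ] G) {g : ℝ → D} {s : Finset D} {φ : D → ℝ → ℂ}
    (hφ : ∀ i ∈ s, Integrable (φ i)) (hs : ∀ t, g t = ∑ i ∈ s, φ i t • i) (ξ : ℝ) :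
    𝓕 (fun t => S (g t)) ξ = S (∑ i ∈ s, 𝓕 (φ i) ξ • i) := by
  simp_rw [hs, map_sum, map_smul, Real.fourier_eq, ← integral_smul_const, Finset.smul_sum]
  rw [integral_finsetSum]
  · refine Finset.sum_congr rfl fun i hi => integral_congr_ae (Eventually.of_forall fun τ => ?_)
    simp only [smul_assoc]
  · intro i hi
    exact (Real.fourierIntegral_convergent_iff ξ).2 ((hφ i hi).smul_const (S i))

/-- The bilinear estimate for a causal convolution whose symbol is bounded by `C`. -/
theorem norm_integral_inner_convolution_le (T : D →ₗ[ℂ] E) {W : ℝ → E →L[ℂ] E}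
    (hWc : ∀ v, Continuous fun t => W t v) (hWn : ∀ t v, ‖W t v‖ = ‖v‖) {ε : ℝ} (hε : 0 < ε)
    {C : ℝ} (hC : 0 ≤ C) (hB : ∀ lam : ℝ, ∀ v w : D,
      ‖inner ℂ (T w) (∫ τ in Ioi (0 : ℝ), cexp ((I * lam - ε) * τ) • W τ (T v))‖ ≤
        C * (‖(v : F)‖ * ‖(w : F)‖))
    {h k : ℝ → D} (hh : IsTame h) (hk : IsTame k) :
    ‖∫ t, inner ℂ (T (k t)) (∫ τ in Ioi (0 : ℝ), cexp (-(ε * τ : ℝ)) • W τ (T (h (t - τ))))‖ ≤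
      C * ((eLpNorm (fun t => (h t : F)) 2 volume).toReal *
        (eLpNorm (fun t => (k t : F)) 2 volume).toReal) := by
  have hTk := hk.integrable T
  have hTk2 := hk.memLp T
  have hhF := hh.integrable D.subtype
  have hkF := hk.integrable D.subtype
  have hhF2 := hh.memLp D.subtype
  have hkF2 := hk.memLp D.subtype
  obtain ⟨s, φ, hφ, hs⟩ := hh
  obtain ⟨s', ψ, hψ, hs'⟩ := hk
  -- Cutting the kernel off at negative times makes the causal integral an ordinary convolution on
  -- the line, integrable thanks to the damping.
  let K : E → ℝ → E := fun f => (Ioi (0 : ℝ)).indicator fun τ => cexp (-(ε * τ : ℝ)) • W τ f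
  have hKint : ∀ f, Integrable (K f) := by
    intro f
    rw [integrable_indicator_iff measurableSet_Ioi]
    refine Integrable.mono' ((exp_neg_integrableOn_Ioi 0 hε).mul_const ‖f‖)
      (Continuous.aestronglyMeasurable ?_) (Eventually.of_forall fun τ => ?_)
    · exact (by fun_prop : Continuous fun τ : ℝ => cexp (-(ε * τ : ℝ))).smul (hWc f)
    · rw [norm_smul, hWn, Complex.norm_exp]
      simp
  let u : ℝ → E := fun t =>
    ∑ i ∈ s, convolution (φ i) (K (T i)) (ContinuousLinearMap.lsmul ℂ ℂ) volume t
  have hprod : ∀ i ∈ s, ∀ t, Integrable fun τ => φ i (t - τ) • K (T i) τ := by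
    intro i hi t
    obtain ⟨M, hM⟩ := (hφ i hi).2
    exact (hKint (T i)).bdd_smul M ((hφ i hi).1.comp_sub_left t).1
      (Eventually.of_forall fun τ => hM _)
  have hu_eq : ∀ t, ∫ τ in Ioi (0 : ℝ), cexp (-(ε * τ : ℝ)) • W τ (T (h (t - τ))) = u t := by
    intro t
    simp only [u, convolution_lsmul_swap]
    rw [← integral_finsetSum _ fun i hi => hprod i hi t, ← integral_indicator measurableSet_Ioi]
    refine integral_congr_ae (Eventually.of_forall fun τ => ?_)
    by_cases hτ : τ ∈ Ioi (0 : ℝ)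
    · simp only [K, indicator_of_mem hτ, hs, map_sum, map_smul, Finset.smul_sum]
      exact Finset.sum_congr rfl fun i _ => smul_comm _ _ _
    · simp [K, indicator_of_notMem hτ]
  have hu_int : Integrable u :=
    integrable_finsetSum _ fun i hi => (hφ i hi).1.integrable_convolution _ (hKint _)
  have hu2 : MemLp u 2 := by
    refine memLp_finsetSum _ fun i hi => ?_
    obtain ⟨M, hM⟩ := (hφ i hi).2
    refine memLp_two_of_integrable_of_bound ((hφ i hi).1.integrable_convolution _ (hKint _))
      (M := ∫ τ, M * ‖K (T i) τ‖) fun t => ?_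
    rw [convolution_lsmul_swap]
    refine norm_integral_le_of_norm_le ((hKint _).norm.const_mul M)
      (Eventually.of_forall fun τ => ?_)
    rw [norm_smul]
    exact mul_le_mul_of_nonneg_right (hM _) (norm_nonneg _)
  simp_rw [hu_eq]
  rw [integral_inner_fourier hTk hTk2 hu_int hu2]
  let hhat : ℝ → D := fun ξ => ∑ i ∈ s, 𝓕 (φ i) ξ • i
  let khat : ℝ → D := fun ξ => ∑ i ∈ s', 𝓕 (ψ i) ξ • i
  have hk_four : ∀ ξ, 𝓕 (fun t => T (k t)) ξ = T (khat ξ) :=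
    fourier_finsetSum T (fun i hi => (hψ i hi).1) hs'
  have hkF_four : ∀ ξ, 𝓕 (fun t => (k t : F)) ξ = khat ξ :=
    fourier_finsetSum D.subtype (fun i hi => (hψ i hi).1) hs'
  have hhF_four : ∀ ξ, 𝓕 (fun t => (h t : F)) ξ = hhat ξ :=
    fourier_finsetSum D.subtype (fun i hi => (hφ i hi).1) hs
  have hLint : ∀ (ξ : ℝ) (f : E), IntegrableOn
      (fun τ : ℝ => cexp ((I * ((-2 * Real.pi * ξ : ℝ) : ℂ) - ε) * τ) • W τ f) (Ioi 0) := by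
    intro ξ f
    refine Integrable.mono' ((exp_neg_integrableOn_Ioi 0 hε).mul_const ‖f‖)
      (Continuous.aestronglyMeasurable ?_) (Eventually.of_forall fun τ => ?_)
    · exact (by fun_prop : Continuous fun τ : ℝ =>
        cexp ((I * ((-2 * Real.pi * ξ : ℝ) : ℂ) - ε) * τ)).smul (hWc f)
    · rw [norm_smul, hWn, Complex.norm_exp]
      simp
  have hK_four : ∀ (ξ : ℝ) (f : E), 𝓕 (K f) ξ = ∫ τ in Ioi (0 : ℝ),
      cexp ((I * ((-2 * Real.pi * ξ : ℝ) : ℂ) - ε) * τ) • W τ f := by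
    intro ξ f
    rw [Real.fourier_eq', ← integral_indicator measurableSet_Ioi]
    refine integral_congr_ae (Eventually.of_forall fun τ => ?_)
    by_cases hτ : τ ∈ Ioi (0 : ℝ)
    · simp only [K, indicator_of_mem hτ]
      rw [smul_smul, ← Complex.exp_add]
      congr 2
      simp
      ring
    · simp [K, indicator_of_notMem hτ]
  -- The convolution theorem: at frequency `ξ` the multiplier is the Laplace transform at `lam =
  -- -2πξ`.
  have hu_four : ∀ ξ, 𝓕 u ξ = ∫ τ in Ioi (0 : ℝ),
      cexp ((I * ((-2 * Real.pi * ξ : ℝ) : ℂ) - ε) * τ) • W τ (T (hhat ξ)) := by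
    intro ξ
    have h1 : 𝓕 u ξ = ∑ i ∈ s, 𝓕 (φ i) ξ • 𝓕 (K (T i)) ξ := by
      simp only [u]
      rw [Real.fourier_eq]
      simp_rw [Finset.smul_sum]
      rw [integral_finsetSum]
      · refine Finset.sum_congr rfl fun i hi => ?_
        rw [← Real.fourier_smul_convolution_eq (hφ i hi).1 (hKint _), Real.fourier_eq]
      · intro i hi
        exact (Real.fourierIntegral_convergent_iff ξ).2
          ((hφ i hi).1.integrable_convolution _ (hKint _))
    simp_rw [h1, hK_four, ← integral_smul]
    refine (integral_finsetSum s fun i _ => (hLint ξ (T i)).smul (𝓕 (φ i) ξ)).symm.trans ?_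
    refine integral_congr_ae (Eventually.of_forall fun τ => ?_)
    simp only [hhat, map_sum, map_smul, Finset.smul_sum]
    exact Finset.sum_congr rfl fun i _ => smul_comm _ _ _
  have hfh := memLp_fourier hhF hhF2
  have hfk := memLp_fourier hkF hkF2
  obtain ⟨hi, hle⟩ := integral_norm_mul_norm_le hfh hfk
  rw [eLpNorm_fourier hhF hhF2, eLpNorm_fourier hkF hkF2] at hle
  -- The symbol bound holds pointwise in `ξ`; Cauchy–Schwarz and Plancherel in `F` then return to
  -- the norms of `h` and `k`.
  refine (norm_integral_le_of_norm_le (hi.const_mul C) (Eventually.of_forall fun ξ => ?_)).trans ?_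
  · rw [hk_four, hu_four]
    have := hB (-2 * Real.pi * ξ) (hhat ξ) (khat ξ)
    rwa [← hhF_four, ← hkF_four] at this
  · rw [integral_const_mul]
    exact mul_le_mul_of_nonneg_left hle hC

end Multiplier

/-! ### Step functions and duality in `L²` -/

section Step

variable {F : Type*} [NormedAddCommGroup F] [InnerProductSpace ℂ F] [CompleteSpace F]
  {D : Submodule ℂ F}

theorem IsStep.nullMeasurableSet_preimage {h : ℝ → D} (hh : IsStep h) (v : D) :
    NullMeasurableSet {t | h t = v} :=
  hh.aestronglyMeasurable.nullMeasurableSet_eq_fun aestronglyMeasurable_const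

theorem IsStep.nullMeasurableSet_support {h : ℝ → D} (hh : IsStep h) :
    NullMeasurableSet (Function.support h) :=
  (hh.nullMeasurableSet_preimage 0).compl

theorem IsStep.volume_support_lt_top {h : ℝ → D} (hh : IsStep h) :
    volume (Function.support h) < ⊤ :=
  hh.bounded_support.measure_lt_top

theorem IsStep.comp_neg {h : ℝ → D} (hh : IsStep h) : IsStep fun t => h (-t) where
  aestronglyMeasurable :=
    hh.aestronglyMeasurable.comp_quasiMeasurePreserving (quasiMeasurePreserving_neg volume)
  finite_range := hh.finite_range.subset (range_comp_subset_range (fun t => -t) h)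
  bounded_support := by
    have : Function.support (fun t => h (-t)) = -Function.support h := rfl
    rw [this]
    exact hh.bounded_support.neg

theorem IsStep.indicator {h : ℝ → D} (hh : IsStep h) {s : Set ℝ} (hs : MeasurableSet s) :
    IsStep (s.indicator h) where
  aestronglyMeasurable := hh.aestronglyMeasurable.indicator hs
  finite_range := by
    refine (hh.finite_range.insert 0).subset ?_
    rintro _ ⟨t, rfl⟩
    by_cases ht : t ∈ s
    · exact Or.inr ⟨t, (indicator_of_mem ht h).symm⟩
    · exact Or.inl (indicator_of_notMem ht h)
  bounded_support := hh.bounded_support.subset (by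
    rw [support_indicator]; exact inter_subset_right)

/-- A step function with a locally bounded scalar weight is tame. -/
theorem IsStep.isTame_smul {h : ℝ → D} (hh : IsStep h) {c : ℝ → ℂ}
    (hc : Continuous c) : IsTame fun t => c t • h t := by
  classical
  obtain ⟨M, hM⟩ : ∃ M, ∀ t ∈ Function.support h, ‖c t‖ ≤ M := by
    obtain ⟨M, hM⟩ := (hh.bounded_support.isCompact_closure.image hc).isBounded.exists_norm_le
    exact ⟨M, fun t ht => hM _ (mem_image_of_mem c (subset_closure ht))⟩
  let S : D → Set ℝ := fun i => {t | h t = i} ∩ Function.support h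
  refine ⟨hh.finite_range.toFinset, fun i => (S i).indicator c, fun i _ => ⟨?_, max M 0, ?_⟩, ?_⟩
  · have hS : NullMeasurableSet (S i) :=
      (hh.nullMeasurableSet_preimage i).inter hh.nullMeasurableSet_support
    refine IntegrableOn.integrable_indicator₀ ?_ hS
    refine Measure.integrableOn_of_bounded (M := M)
      ((measure_mono inter_subset_right).trans_lt hh.volume_support_lt_top).ne
      hc.aestronglyMeasurable ?_
    rw [ae_restrict_iff'₀ hS]
    exact Eventually.of_forall fun t ht => hM t ht.2
  · intro t
    simp only
    by_cases ht : t ∈ S i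
    · rw [indicator_of_mem ht]
      exact (hM t ht.2).trans (le_max_left _ _)
    · rw [indicator_of_notMem ht, norm_zero]
      exact le_max_right _ _
  · intro t
    simp only
    by_cases ht : h t = 0
    · rw [ht, smul_zero]
      refine (Finset.sum_eq_zero fun i _ => ?_).symm
      rw [indicator_of_notMem, zero_smul]
      exact fun hti => hti.2 ht
    · rw [Finset.sum_eq_single (h t)]
      · rw [indicator_of_mem]
        exact ⟨rfl, ht⟩
      · intro i _ hi
        rw [indicator_of_notMem, zero_smul]
        exact fun hti => hi hti.1.symm
      · intro hn
        exact absurd (hh.finite_range.mem_toFinset.2 ⟨t, rfl⟩) hn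

theorem IsStep.isTame {h : ℝ → D} (hh : IsStep h) : IsTame h := by
  simpa using hh.isTame_smul (c := fun _ => 1) continuous_const

/-- If `D` is dense, the `L²` norm is determined by pairings with `D`-valued step functions. -/
theorem eLpNorm_le_of_forall_step (hD : Dense (D : Set F)) {g : ℝ → F}
    (hg : AEStronglyMeasurable g) {C : ℝ} (hC : 0 ≤ C)
    (hb : ∀ k : ℝ → D, IsStep k → ‖∫ t, inner ℂ (k t : F) (g t)‖ ≤
      C * (eLpNorm (fun t => (k t : F)) 2 volume).toReal) :
    eLpNorm g 2 volume ≤ ENNReal.ofReal C := by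
  wlog hgm : StronglyMeasurable g generalizing g with key
  · rw [eLpNorm_congr_ae hg.ae_eq_mk]
    refine key hg.stronglyMeasurable_mk.aestronglyMeasurable (fun k hk => ?_)
      hg.stronglyMeasurable_mk
    rw [← integral_congr_ae (f := fun t => inner ℂ (k t : F) (g t))]
    · exact hb k hk
    · filter_upwards [hg.ae_eq_mk] with t ht
      rw [ht]
  -- Nothing is known about integrability of `g`, so it is truncated in size and in time; Fatou
  -- removes the truncation at the end.
  let S : ℕ → Set ℝ := fun n => {t | ‖g t‖ ≤ n} ∩ Icc (-(n : ℝ)) n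
  have hSm : ∀ n, MeasurableSet (S n) := fun n =>
    (hgm.norm.measurable measurableSet_Iic).inter measurableSet_Icc
  have hSfin : ∀ n, volume (S n) < ⊤ := fun n =>
    (measure_mono inter_subset_right).trans_lt measure_Icc_lt_top
  let G : ℕ → ℝ → F := fun n => (S n).indicator g
  have hGm : ∀ n, MemLp (G n) 2 volume := by
    intro n
    rw [memLp_indicator_iff_restrict (hSm n)]
    have : IsFiniteMeasure (volume.restrict (S n)) := ⟨by simpa using hSfin n⟩
    refine MemLp.of_bound hgm.aestronglyMeasurable n ?_
    rw [ae_restrict_iff' (hSm n)]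
    exact Eventually.of_forall fun t ht => ht.1
  -- A simple function approximates the truncation, and each of its values is then moved by at most
  -- `δ` into the dense subspace. Vanishing off `S n` lets `k` pair with `g` as it does with `G n`.
  have hstep : ∀ n, ∀ η > 0, ∃ k : ℝ → D, IsStep k ∧ (∀ t ∉ S n, k t = 0) ∧
      eLpNorm (fun t => G n t - k t) 2 volume ≤ ENNReal.ofReal η := by
    intro n η hη
    obtain ⟨δ, hδ, hδη⟩ : ∃ δ > 0, δ * (volume (S n)).toReal ^ (1 / 2 : ℝ) ≤ η / 2 := by
      refine ⟨η / 2 / ((volume (S n)).toReal ^ (1 / 2 : ℝ) + 1), by positivity, ?_⟩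
      rw [div_mul_eq_mul_div, div_le_iff₀ (by positivity)]
      have : (0 : ℝ) ≤ (volume (S n)).toReal ^ (1 / 2 : ℝ) := by positivity
      nlinarith
    obtain ⟨f, hf, hf2⟩ := (hGm n).exists_simpleFunc_eLpNorm_sub_lt (by norm_num)
      (ε := ENNReal.ofReal (η / 2)) (by simpa using hη)
    have hc : ∀ x : F, ∃ y : D, ‖x - y‖ ≤ δ := fun x => by
      obtain ⟨y, hy, hxy⟩ := Metric.mem_closure_iff.1 (hD x) δ hδ
      exact ⟨⟨y, hy⟩, by rw [← dist_eq_norm]; exact hxy.le⟩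
    choose c hc using hc
    refine ⟨(S n).indicator (f.map c), ⟨?_, ?_, ?_⟩, fun t ht => indicator_of_notMem ht _, ?_⟩
    · exact ((f.map c).stronglyMeasurable.indicator (hSm n)).aestronglyMeasurable
    · refine ((f.map c).finite_range.insert 0).subset ?_
      rintro _ ⟨t, rfl⟩
      by_cases ht : t ∈ S n
      · exact Or.inr ⟨t, (indicator_of_mem ht _).symm⟩
      · exact Or.inl (indicator_of_notMem ht _)
    · refine (Metric.isBounded_Icc (-(n : ℝ)) n).subset ?_
      rw [support_indicator]
      exact fun t ht => ht.1.2
    · have hsplit : (fun t => G n t - ((S n).indicator (f.map c) t : D)) =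
          fun t => (S n).indicator (G n - ⇑f) t + (S n).indicator (fun t => f t - c (f t)) t := by
        funext t
        by_cases ht : t ∈ S n
        · simp [G, indicator_of_mem ht]
        · simp [G, indicator_of_notMem ht]
      rw [hsplit]
      have hfc : StronglyMeasurable fun t => f t - (c (f t) : F) :=
        f.stronglyMeasurable.sub (continuous_subtype_val.comp_stronglyMeasurable
          (f.map c).stronglyMeasurable)
      refine (eLpNorm_add_le (((hGm n).1.sub f.aestronglyMeasurable).indicator (hSm n))
        (hfc.indicator (hSm n)).aestronglyMeasurable (by norm_num)).trans ?_
      rw [← add_halves η, ENNReal.ofReal_add (by positivity) (by positivity)]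
      refine add_le_add ((eLpNorm_indicator_le _).trans hf.le) ?_
      rw [eLpNorm_indicator_eq_eLpNorm_restrict (hSm n)]
      refine (eLpNorm_le_of_ae_bound (C := δ) (Eventually.of_forall fun t => hc _)).trans ?_
      rw [Measure.restrict_apply_univ, ← ENNReal.ofReal_toReal (hSfin n).ne,
        ENNReal.ofReal_rpow_of_nonneg ENNReal.toReal_nonneg (by positivity),
        ← ENNReal.ofReal_mul (by positivity), mul_comm]
      refine ENNReal.ofReal_le_ofReal (le_trans (le_of_eq ?_) hδη)
      norm_num
  have hGn : ∀ n, eLpNorm (G n) 2 volume ≤ ENNReal.ofReal C := by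
    intro n
    set x := (eLpNorm (G n) 2 volume).toReal with hx
    have hfin : eLpNorm (G n) 2 volume ≠ ⊤ := (hGm n).2.ne
    rw [ENNReal.le_ofReal_iff_toReal_le hfin hC, ← hx]
    have hx0 : 0 ≤ x := ENNReal.toReal_nonneg
    have main : ∀ η > 0, x * x ≤ C * x + η * (C + x) := by
      intro η hη
      obtain ⟨k, hk, hks, hke⟩ := hstep n η hη
      have hk2 : MemLp (fun t => (k t : F)) 2 := hk.isTame.memLp D.subtype
      have hd2 : MemLp (fun t => G n t - k t) 2 := (hGm n).sub hk2
      have hde : (eLpNorm (fun t => G n t - k t) 2 volume).toReal ≤ η :=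
        ENNReal.toReal_le_of_le_ofReal hη.le hke
      have hkn : (eLpNorm (fun t => (k t : F)) 2 volume).toReal ≤ x + η := by
        have h1 : (fun t => (k t : F)) = G n - fun t => G n t - k t := by
          funext t; simp
        have h2 := eLpNorm_sub_le (hGm n).1 hd2.1 (p := 2) (by norm_num)
        rw [← h1] at h2
        refine (ENNReal.toReal_mono (ENNReal.add_ne_top.2 ⟨hfin, hd2.2.ne⟩) h2).trans ?_
        rw [ENNReal.toReal_add hfin hd2.2.ne]
        gcongr
      have hi1 : Integrable fun t => inner ℂ (G n t) (G n t) := by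
        have := (integral_norm_mul_norm_le (hGm n) (hGm n)).1
        exact this.mono' ((hGm n).1.inner (hGm n).1)
          (Eventually.of_forall fun t => norm_inner_le_norm _ _)
      have hi2 : Integrable fun t => inner ℂ (G n t - k t) (G n t) := by
        have := (integral_norm_mul_norm_le hd2 (hGm n)).1
        exact this.mono' (hd2.1.inner (hGm n).1)
          (Eventually.of_forall fun t => norm_inner_le_norm _ _)
      have e1 : ∫ t, inner ℂ (k t : F) (g t) =
          (∫ t, inner ℂ (G n t) (G n t)) - ∫ t, inner ℂ (G n t - k t) (G n t) := by
        rw [← integral_sub hi1 hi2]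
        refine integral_congr_ae (Eventually.of_forall fun t => ?_)
        simp only [← inner_sub_left, sub_sub_cancel]
        by_cases ht : t ∈ S n
        · simp only [G, indicator_of_mem ht]
        · rw [hks t ht]; simp
      have e2 : ‖∫ t, inner ℂ (G n t) (G n t)‖ = x * x := by
        have h3 := L2.inner_def (𝕜 := ℂ) ((hGm n).toLp _) ((hGm n).toLp _)
        rw [integral_congr_ae (g := fun t => inner ℂ (G n t) (G n t))] at h3
        · rw [← h3, inner_self_eq_norm_sq_to_K, Lp.norm_toLp, ← hx]
          rw [norm_pow, RCLike.norm_ofReal, abs_of_nonneg hx0, sq]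
        · filter_upwards [(hGm n).coeFn_toLp] with t ht
          rw [ht]
      have e3 := norm_integral_inner_le hd2 (hGm n)
      have e4 := hb k hk
      rw [e1] at e4
      have e5 := norm_sub_norm_le (∫ t, inner ℂ (G n t) (G n t))
        (∫ t, inner ℂ (G n t - k t) (G n t))
      rw [e2] at e5
      have e6 : C * (eLpNorm (fun t => (k t : F)) 2 volume).toReal ≤ C * (x + η) := by gcongr
      have e7 : (eLpNorm (fun t => G n t - k t) 2 volume).toReal * x ≤ η * x := by gcongr
      nlinarith
    by_contra! hlt
    have hpos : 0 < x := hC.trans_lt hlt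
    -- With this `η` the error term is half of `(x - C) x`, which contradicts `main` when `x > C`.
    have := main ((x - C) * x / (2 * (C + x))) (by
      have := sub_pos.2 hlt
      positivity)
    have h8 : (x - C) * x / (2 * (C + x)) * (C + x) = (x - C) * x / 2 := by
      field_simp
    rw [h8] at this
    nlinarith [mul_pos (sub_pos.2 hlt) hpos]
  refine (Lp.eLpNorm_lim_le_liminf_eLpNorm (fun n => (hGm n).1) g
    (Eventually.of_forall fun t => ?_)).trans
    (liminf_le_of_frequently_le' (Eventually.of_forall hGn).frequently)
  refine tendsto_const_nhds.congr' ?_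
  obtain ⟨N, hN⟩ := exists_nat_ge (max ‖g t‖ |t|)
  filter_upwards [eventually_ge_atTop N] with n hn
  have hn' : max ‖g t‖ |t| ≤ n := hN.trans (by exact_mod_cast hn)
  have : t ∈ S n := ⟨(le_max_left _ _).trans hn', abs_le.1 ((le_max_right _ _).trans hn')⟩
  exact (indicator_of_mem this g).symm

end Step

/-! ### Causal estimates with exponential weights -/

section Smoothing

open Complex

variable {E F : Type*} [NormedAddCommGroup E] [InnerProductSpace ℂ E] [CompleteSpace E]
  [NormedAddCommGroup F] [InnerProductSpace ℂ F] [CompleteSpace F] {D : Submodule ℂ F}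

/-- The Laplace transform of `T* W T` is bounded by `C` on the line `Re = ε`. -/
def LaplaceBound (T : D →ₗ[ℂ] E) (W : ℝ → E →L[ℂ] E) (C ε : ℝ) : Prop :=
  ∀ lam : ℝ, ∀ v w : D,
    ‖inner ℂ (T w) (∫ τ in Ioi (0 : ℝ), cexp ((I * lam - ε) * τ) • W τ (T v))‖ ≤
      C * (‖(v : F)‖ * ‖(w : F)‖)

/-- The causal estimate with the weight `e^{-εt}`. -/
theorem norm_integral_inner_weighted_causal_le {T : D →ₗ[ℂ] E} {W : ℝ → E →L[ℂ] E}
    (hWc : ∀ v, Continuous fun t => W t v) (hWn : ∀ t v, ‖W t v‖ = ‖v‖) {ε : ℝ} (hε : 0 < ε)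
    {C : ℝ} (hC : 0 ≤ C) (hB : LaplaceBound T W C ε) {h k : ℝ → D} (hh : IsStep h)
    (hk : IsTame k) :
    ‖∫ t, inner ℂ (T (k t)) (Real.exp (-ε * t) • ∫ τ in Ioi (0 : ℝ), W τ (T (h (t - τ))))‖ ≤
      C * ((eLpNorm (fun t => Real.exp (-ε * t) • (h t : F)) 2 volume).toReal *
        (eLpNorm (fun t => (k t : F)) 2 volume).toReal) := by
  have h1 := hh.isTame_smul (c := fun t => ((Real.exp (-ε * t) : ℝ) : ℂ)) (by fun_prop)
  have h3 := norm_integral_inner_convolution_le T hWc hWn hε hC hB h1 hk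
  simp only [Complex.coe_smul] at h3
  refine le_trans (le_of_eq (congrArg norm (integral_congr_ae (Eventually.of_forall fun t => ?_))))
    h3
  simp only
  -- The weight factors as `e^{-εt} = e^{-ετ} e^{-ε(t-τ)}`: one factor damps the kernel, the other
  -- is absorbed into `h`.
  have h4 : ∫ τ in Ioi (0 : ℝ), cexp (-(ε * τ : ℝ)) • W τ
      (T (((Real.exp (-ε * (t - τ)) : ℝ) : ℂ) • h (t - τ))) =
      ((Real.exp (-ε * t) : ℝ) : ℂ) • ∫ τ in Ioi (0 : ℝ), W τ (T (h (t - τ))) := by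
    rw [← integral_smul]
    refine integral_congr_ae (Eventually.of_forall fun τ => ?_)
    simp only [map_smul, smul_smul]
    congr 1
    rw [← Complex.ofReal_neg, ← Complex.ofReal_exp, ← Complex.ofReal_mul, ← Real.exp_add]
    congr 2
    ring
  simp only [Complex.coe_smul] at h4
  rw [h4]

theorem norm_integral_inner_causal_le {T : D →ₗ[ℂ] E} {W : ℝ → E →L[ℂ] E}
    (hWc : ∀ v, Continuous fun t => W t v) (hWn : ∀ t v, ‖W t v‖ = ‖v‖) {ε : ℝ} (hε : 0 < ε)
    {C : ℝ} (hC : 0 ≤ C) (hB : LaplaceBound T W C ε) {h k : ℝ → D} (hh : IsStep h)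
    (hk : IsStep k) :
    ‖∫ t, inner ℂ (T (k t)) (∫ τ in Ioi (0 : ℝ), W τ (T (h (t - τ))))‖ ≤
      C * ((eLpNorm (fun t => Real.exp (-ε * t) • (h t : F)) 2 volume).toReal *
        (eLpNorm (fun t => Real.exp (ε * t) • (k t : F)) 2 volume).toReal) := by
  have h2 := hk.isTame_smul (c := fun t => ((Real.exp (ε * t) : ℝ) : ℂ)) (by fun_prop)
  have h3 := norm_integral_inner_weighted_causal_le hWc hWn hε hC hB hh h2
  refine le_trans (le_of_eq (congrArg norm (integral_congr_ae (Eventually.of_forall fun t => ?_))))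
    h3
  simp only
  rw [← Complex.coe_smul (Real.exp (-ε * t)), map_smul,
    inner_smul_left, inner_smul_right, ← mul_assoc, Complex.conj_ofReal, ← Complex.ofReal_mul,
    ← Real.exp_add]
  simp

end Smoothing

/-! ### The `TT*` argument and Kato smoothing -/

section Smoothing

open Complex

variable {E F : Type*} [NormedAddCommGroup E] [InnerProductSpace ℂ E] [CompleteSpace E]
  [NormedAddCommGroup F] [InnerProductSpace ℂ F] [CompleteSpace F] {D : Submodule ℂ F}

theorem continuous_uncurry_of_norm {W : ℝ → E →L[ℂ] E} (hWc : ∀ v, Continuous fun t => W t v)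
    (hWn : ∀ t v, ‖W t v‖ = ‖v‖) : Continuous fun p : ℝ × E => W p.1 p.2 := by
  refine continuous_iff_continuousAt.2 fun ⟨s, y⟩ => ?_
  rw [ContinuousAt, tendsto_iff_norm_sub_tendsto_zero]
  have h1 : Tendsto (fun p : ℝ × E => ‖p.2 - y‖ + ‖W p.1 y - W s y‖) (𝓝 (s, y)) (𝓝 0) := by
    have : Continuous fun p : ℝ × E => ‖p.2 - y‖ + ‖W p.1 y - W s y‖ :=
      (continuous_snd.sub continuous_const).norm.add
        (((hWc y).comp continuous_fst).sub continuous_const).norm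
    simpa using this.tendsto (s, y)
  refine squeeze_zero (fun _ => norm_nonneg _) (fun p => ?_) h1
  rw [← hWn p.1 (p.2 - y), map_sub]
  exact norm_sub_le_norm_sub_add_norm_sub _ _ _

theorem aestronglyMeasurable_group_apply {W : ℝ → E →L[ℂ] E}
    (hWc : ∀ v, Continuous fun t => W t v) (hWn : ∀ t v, ‖W t v‖ = ‖v‖) {α : Type*}
    [MeasurableSpace α] {μ : Measure α} {τ : α → ℝ} (hτ : AEStronglyMeasurable τ μ) {f : α → E}
    (hf : AEStronglyMeasurable f μ) : AEStronglyMeasurable (fun x => W (τ x) (f x)) μ :=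
  (continuous_uncurry_of_norm hWc hWn).comp_aestronglyMeasurable (hτ.prodMk hf)

theorem aestronglyMeasurable_causal {W : ℝ → E →L[ℂ] E}
    (hWc : ∀ v, Continuous fun t => W t v) (hWn : ∀ t v, ‖W t v‖ = ‖v‖) {f : ℝ → E}
    (hf : AEStronglyMeasurable f) (S : Set ℝ) :
    AEStronglyMeasurable fun t => ∫ τ in S, W τ (f (t - τ)) := by
  refine AEStronglyMeasurable.integral_prod_right'
    (f := fun p : ℝ × ℝ => W p.2 (f (p.1 - p.2))) ?_
  exact aestronglyMeasurable_group_apply hWc hWn measurable_snd.aestronglyMeasurable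
    (hf.comp_quasiMeasurePreserving (quasiMeasurePreserving_sub _ _))

theorem integral_inner_left {α : Type*} [MeasurableSpace α] {μ : Measure α} {f : α → E}
    (hf : Integrable f μ) (c : E) : ∫ x, inner ℂ (f x) c ∂μ = inner ℂ (∫ x, f x ∂μ) c := by
  rw [← inner_conj_symm, ← integral_inner hf c, ← integral_conj]
  simp only [inner_conj_symm]

theorem eLpNorm_comp_neg {G : Type*} [NormedAddCommGroup G] {f : ℝ → G}
    (hf : AEStronglyMeasurable f) (p : ℝ≥0∞) :
    eLpNorm (fun t => f (-t)) p volume = eLpNorm f p volume :=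
  eLpNorm_comp_measurePreserving hf (Measure.measurePreserving_neg volume)

theorem IsStep.norm_weighted_le {k : ℝ → D} (hk : IsStep k) {R : ℝ}
    (hR : ∀ t ∈ Function.support k, |t| ≤ R) (c : ℝ) :
    (eLpNorm (fun t => Real.exp (c * t) • (k t : F)) 2 volume).toReal ≤
      Real.exp (|c| * R) * (eLpNorm (fun t => (k t : F)) 2 volume).toReal := by
  have hk2 : MemLp (fun t => (k t : F)) 2 := hk.isTame.memLp D.subtype
  have h1 := eLpNorm_le_mul_eLpNorm_of_ae_le_mul (μ := volume) (c := Real.exp (|c| * R))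
    (f := fun t => Real.exp (c * t) • (k t : F)) (g := fun t => (k t : F))
    (Eventually.of_forall fun t => ?_) 2
  · refine (ENNReal.toReal_mono (ENNReal.mul_ne_top ENNReal.ofReal_ne_top hk2.2.ne) h1).trans ?_
    rw [ENNReal.toReal_mul, ENNReal.toReal_ofReal (Real.exp_pos _).le]
  · rw [norm_smul, Real.norm_of_nonneg (Real.exp_pos _).le]
    by_cases ht : k t = 0
    · simp [ht]
    · refine mul_le_mul_of_nonneg_right (Real.exp_le_exp.2 ?_) (norm_nonneg _)
      calc c * t ≤ |c| * |t| := by rw [← abs_mul]; exact le_abs_self _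
        _ ≤ |c| * R := by gcongr; exact hR t ht

/-- The dual (`TT*`) form of the smoothing estimate. -/
theorem norm_integral_group_le {T : D →ₗ[ℂ] E} {U : ℝ → E →L[ℂ] E} (h0 : U 0 = 1)
    (hadd : ∀ s t, U (s + t) = U s * U t) (hUc : ∀ v, Continuous fun t => U t v)
    (hUn : ∀ t v, ‖U t v‖ = ‖v‖) {ε₀ C : ℝ} (hε₀ : 0 < ε₀) (hC : 0 ≤ C)
    (hB : ∀ ε, 0 < ε → ε < ε₀ → LaplaceBound T U C ε)
    (hB' : ∀ ε, 0 < ε → ε < ε₀ → LaplaceBound T (fun t => U (-t)) C ε) {k : ℝ → D}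
    (hk : IsStep k) :
    ‖∫ s, U (-s) (T (k s))‖ ≤
      √(6 * C) * (eLpNorm (fun t => (k t : F)) 2 volume).toReal := by
  set N := (eLpNorm (fun t => (k t : F)) 2 volume).toReal with hN
  have hN0 : 0 ≤ N := ENNReal.toReal_nonneg
  set f : ℝ → E := fun s => T (k s) with hf
  have hfint : Integrable f := hk.isTame.integrable T
  have hUc' : ∀ v, Continuous fun t => U (-t) v := fun v => (hUc v).comp continuous_neg
  have hUn' : ∀ t v, ‖U (-t) v‖ = ‖v‖ := fun t v => hUn _ _
  have hYint : Integrable fun s => U (-s) (f s) :=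
    hfint.norm.mono' (aestronglyMeasurable_group_apply hUc' hUn' aestronglyMeasurable_id hfint.1)
      (Eventually.of_forall fun s => (hUn' _ _).le)
  set Y := ∫ s, U (-s) (f s) with hY
  set P : ℝ → E := fun t => ∫ τ in Ioi (0 : ℝ), U τ (f (t - τ)) with hP
  set Q : ℝ → E := fun t => ∫ τ in Iic (0 : ℝ), U τ (f (t - τ)) with hQ
  have hint : ∀ t, Integrable fun τ => U τ (f (t - τ)) := fun t =>
    (hfint.comp_sub_left t).norm.mono'
      (aestronglyMeasurable_group_apply hUc hUn aestronglyMeasurable_id (hfint.comp_sub_left t).1)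
      (Eventually.of_forall fun s => (hUn _ _).le)
  -- The group law turns `U(t) Y` into a convolution over the whole line, split at `τ = 0` into its
  -- causal part `P` and anticausal part `Q`.
  have hUY : ∀ t, U t Y = P t + Q t := by
    intro t
    rw [hY, ← ContinuousLinearMap.integral_comp_comm _ hYint]
    have h1 : ∀ s, U t (U (-s) (f s)) = U (t - s) (f (t - (t - s))) := fun s => by
      rw [← mul_apply_eq_comp, ← hadd, sub_sub_cancel, sub_eq_add_neg]
    simp_rw [h1]
    rw [integral_sub_left_eq_self (fun τ => U τ (f (t - τ))) volume t,
      ← integral_add_compl (measurableSet_Ioi (a := (0 : ℝ))) (hint t), compl_Ioi]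
  have hpair : ∀ S : Set ℝ, Integrable fun t => inner ℂ (f t) (∫ τ in S, U τ (f (t - τ))) := by
    intro S
    refine (hfint.norm.mul_const (∫ τ, ‖f τ‖)).mono'
      (hfint.1.inner (aestronglyMeasurable_causal hUc hUn hfint.1 S))
      (Eventually.of_forall fun t => (norm_inner_le_norm _ _).trans ?_)
    gcongr
    rw [← integral_sub_left_eq_self (fun τ => ‖f τ‖) volume t]
    refine (norm_integral_le_integral_norm _).trans ?_
    simp_rw [hUn]
    exact setIntegral_le_integral (hfint.comp_sub_left t).norm
      (Eventually.of_forall fun _ => norm_nonneg _)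
  have hYY : inner ℂ Y Y = (∫ t, inner ℂ (f t) (P t)) + ∫ t, inner ℂ (f t) (Q t) := by
    rw [← integral_add (hpair _) (hpair _)]
    conv_lhs => rw [hY]
    rw [← integral_inner_left hYint]
    refine integral_congr_ae (Eventually.of_forall fun t => ?_)
    simp only
    rw [inner_group_left h0 hadd hUn, neg_neg, hUY, inner_add_right]
  obtain ⟨R, hR0, hR⟩ : ∃ R : ℝ, 0 ≤ R ∧ ∀ t ∈ Function.support k, |t| ≤ R := by
    obtain ⟨R, hR⟩ := hk.bounded_support.exists_norm_le
    exact ⟨max R 0, le_max_right _ _, fun t ht => (hR t ht).trans (le_max_left _ _)⟩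
  -- With `εR ≤ 1/2` the two weights on the support of `k` cost at most `e ≤ 3` together. Each half
  -- is thus bounded by `3 C N²`, hence the constant `6 C`.
  obtain ⟨ε, hε, hεε₀, hεR⟩ : ∃ ε > 0, ε < ε₀ ∧ ε * R ≤ 1 / 2 := by
    refine ⟨min (ε₀ / 2) (1 / (2 * (R + 1))), by positivity,
      (min_le_left _ _).trans_lt (by linarith), ?_⟩
    calc min (ε₀ / 2) (1 / (2 * (R + 1))) * R ≤ 1 / (2 * (R + 1)) * R := by
          gcongr; exact min_le_right _ _
      _ ≤ 1 / 2 := by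
          rw [div_mul_eq_mul_div, div_le_div_iff₀ (by positivity) (by norm_num)]; linarith
  have hexp : Real.exp (|ε| * R) * Real.exp (|ε| * R) ≤ 3 := by
    rw [← Real.exp_add, abs_of_pos hε]
    refine (Real.exp_le_exp.2 (by linarith : ε * R + ε * R ≤ 1)).trans ?_
    linarith [Real.exp_one_lt_d9]
  have hprod : ∀ {k : ℝ → D}, IsStep k → (∀ t ∈ Function.support k, |t| ≤ R) →
      (eLpNorm (fun t => Real.exp (-ε * t) • (k t : F)) 2 volume).toReal *
        (eLpNorm (fun t => Real.exp (ε * t) • (k t : F)) 2 volume).toReal ≤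
      3 * (eLpNorm (fun t => (k t : F)) 2 volume).toReal ^ 2 := by
    intro k hk hR
    have h1 := hk.norm_weighted_le hR (-ε)
    have h2 := hk.norm_weighted_le hR ε
    rw [abs_neg] at h1
    refine (mul_le_mul h1 h2 ENNReal.toReal_nonneg (by positivity)).trans ?_
    rw [mul_mul_mul_comm, ← sq (eLpNorm _ _ _).toReal]
    gcongr
  have hPb : ‖∫ t, inner ℂ (f t) (P t)‖ ≤ C * (3 * N ^ 2) :=
    (norm_integral_inner_causal_le hUc hUn hε hC (hB ε hε hεε₀) hk hk).trans
      (mul_le_mul_of_nonneg_left (hprod hk hR) hC)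
  -- Reflection in time makes the anticausal half a causal one for the group `U(-t)` and the
  -- function `k(-t)`.
  have hQb : ‖∫ t, inner ℂ (f t) (Q t)‖ ≤ C * (3 * N ^ 2) := by
    have hkn : (eLpNorm (fun t => (k (-t) : F)) 2 volume).toReal = N := by
      rw [hN]
      exact congrArg _ (eLpNorm_comp_neg (hk.isTame.memLp D.subtype).1 2)
    have h1 := (norm_integral_inner_causal_le hUc' hUn' hε hC (hB' ε hε hεε₀) hk.comp_neg
      hk.comp_neg).trans (mul_le_mul_of_nonneg_left (hprod hk.comp_neg fun t ht => by
        simpa using hR (-t) ht) hC)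
    rw [hkn] at h1
    refine le_trans (le_of_eq (congrArg norm ?_)) h1
    rw [← integral_neg_eq_self]
    refine integral_congr_ae (Eventually.of_forall fun t => ?_)
    simp only [hQ, hf]
    congr 1
    have := integral_comp_neg_Ioi (0 : ℝ) fun τ => U τ (T (k (-t - τ)))
    rw [neg_zero] at this
    rw [← this]
    refine integral_congr_ae (Eventually.of_forall fun τ => ?_)
    simp only [neg_sub, sub_neg_eq_add]
    congr 3
    ring
  have hfinal : ‖Y‖ ^ 2 ≤ 6 * C * N ^ 2 := by
    have : ‖Y‖ ^ 2 = ‖inner ℂ Y Y‖ := by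
      rw [inner_self_eq_norm_sq_to_K, norm_pow, RCLike.norm_ofReal, abs_norm]
    rw [this, hYY]
    refine (norm_add_le _ _).trans ?_
    linarith
  rw [← Real.sqrt_sq hN0, ← Real.sqrt_mul (by positivity)]
  exact Real.le_sqrt_of_sq_le hfinal

variable {H : E →ₗ.[ℂ] E} {A : E →ₗ.[ℂ] F} {U : ℝ → E →L[ℂ] E} {a ε₀ : ℝ}

/-- With `z = σ(lam + iε)` one has `iσz = i lam - ε`, so `σ = 1` and `σ = -1` use the resolvent in
the upper and lower half planes. The unimodular factor `-iσ` does not affect the bound. -/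
theorem IsSupersmooth.laplaceBound (hH : IsSelfAdjoint H) (hU : IsUnitaryGroup H U)
    (hs : IsSupersmooth H A a ε₀) {σ : ℝ} (hσ : σ ^ 2 = 1) {ε : ℝ} (hε : 0 < ε) (hεε₀ : ε < ε₀) :
    LaplaceBound A.adjoint.toFun (fun t => U (σ * t)) (2 * a) ε := by
  intro lam v w
  have hσ' : (σ : ℂ) ^ 2 = 1 := by exact_mod_cast hσ
  have habs : |σ * ε| = ε := by
    have : |σ| = 1 := by
      rw [← sq_eq_sq₀ (abs_nonneg _) zero_le_one, sq_abs, hσ, one_pow]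
    rw [abs_mul, this, one_mul, abs_of_pos hε]
  set z : ℂ := ((σ * lam : ℝ) : ℂ) + ((σ * ε : ℝ) : ℂ) * I with hz
  have hzim : z.im = σ * ε := by simp [hz]
  have hz0 : z.im ≠ 0 := by
    rw [hzim, ← abs_pos, habs]; exact hε
  have hzpos : 0 < σ * z.im := by
    rw [hzim, ← mul_assoc, ← sq, hσ, one_mul]; exact hε
  have h1 := (hU.integral_Ioi hH hσ hzpos (A.adjoint v)).2
  have hexp : ∀ τ : ℝ, I * σ * z * τ = (I * lam - ε) * τ := by
    intro τ
    rw [hz]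
    push_cast
    linear_combination (I * lam * τ + I ^ 2 * ε * τ) * hσ' + ε * τ * Complex.I_sq
  simp_rw [hexp] at h1
  have h2 := norm_inner_le_of_numerical_radius A.adjoint.toFun (resCLM hH hz0).toLinearMap
    (a := a) (fun v => by
      have := hs (σ * ε) (σ * lam) (by rw [habs]; exact hε) (by rw [habs]; exact hεε₀) v
      exact this) v w
  have h3 : ‖-(I * (σ : ℂ))‖ = 1 := by
    have : ‖-(I * (σ : ℂ))‖ ^ 2 = 1 := by
      rw [← norm_pow]
      have : (-(I * (σ : ℂ))) ^ 2 = -1 := by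
        linear_combination (σ : ℂ) ^ 2 * Complex.I_sq - hσ'
      rw [this, norm_neg, norm_one]
    exact (pow_eq_one_iff_of_nonneg (norm_nonneg _) two_ne_zero).1 this
  have h4 : ‖inner ℂ (A.adjoint w) ((-(I * (σ : ℂ))) • res H z (A.adjoint v))‖ ≤
      2 * a * (‖(v : F)‖ * ‖(w : F)‖) := by
    rw [inner_smul_right, norm_mul, h3, one_mul, norm_inner_symm]
    exact h2
  rw [← h1] at h4
  exact h4

/-- The imaginary part of the form at `iε` is `-ε ‖R(iε) A* w‖²`. -/
theorem IsSupersmooth.norm_res_le (hH : IsSelfAdjoint H) (hs : IsSupersmooth H A a ε₀) {ε : ℝ}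
    (hε : 0 < |ε|) (hεε₀ : |ε| < ε₀) (w : A.adjoint.domain) :
    ‖res H (ε * I) (A.adjoint w)‖ ≤ √(a / |ε|) * ‖(w : F)‖ := by
  have hz : ((ε : ℂ) * I).im ≠ 0 := by simpa using hε
  have h1 := hs ε 0 hε hεε₀ w
  rw [Complex.ofReal_zero, zero_add] at h1
  have h2 := (Complex.abs_im_le_norm _).trans h1
  rw [im_inner_res hH hz, abs_mul, abs_neg, abs_of_nonneg (sq_nonneg (‖_‖ : ℝ))] at h2
  have h3 : ((ε : ℂ) * I).im = ε := by simp
  rw [h3] at h2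
  rw [← Real.sqrt_sq (norm_nonneg (w : F)), ← Real.sqrt_mul' _ (sq_nonneg _)]
  refine Real.le_sqrt_of_sq_le ?_
  rw [div_mul_eq_mul_div, le_div_iff₀ hε]
  linarith

/-- The dual of `IsSupersmooth.norm_res_le` at `-ε`: since `⟪A* w, R(iε) f⟫ = ⟪R(-iε) A* w, f⟫`, the
operator `A R(iε)` is everywhere defined and bounded. In particular `D(H) ⊆ D(A)`. -/
theorem IsSupersmooth.res_mem (hH : IsSelfAdjoint H) (hA : A.IsClosed)
    (hAd : Dense (A.domain : Set E)) (hs : IsSupersmooth H A a ε₀) {ε : ℝ}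
    (hε : 0 < |ε|) (hεε₀ : |ε| < ε₀) (f : E) :
    res H (ε * I) f ∈ A.domain ∧ ‖val A (res H (ε * I) f)‖ ≤ √(a / |ε|) * ‖f‖ := by
  have hz : ((ε : ℂ) * I).im ≠ 0 := by simpa using hε
  have hz' : (((-ε : ℝ) : ℂ) * I).im ≠ 0 := by simpa using hε
  obtain ⟨h1, h2⟩ := mem_domain_of_bound hA hAd (x := res H (ε * I) f)
    (M := √(a / |ε|) * ‖f‖) (by positivity) fun w => by
      have h3 := inner_res_left hH hz' (A.adjoint w) f
      have h4 : (starRingEnd ℂ) (((-ε : ℝ) : ℂ) * I) = ε * I := by simp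
      rw [h4] at h3
      rw [← h3]
      refine (norm_inner_le_norm _ _).trans ?_
      have := hs.norm_res_le hH (ε := -ε) (by rwa [abs_neg]) (by rwa [abs_neg]) w
      rw [abs_neg] at this
      nlinarith [norm_nonneg f]
  exact ⟨h1, by rwa [val_of_mem h1]⟩

theorem val_sub {x y : E} (hx : x ∈ A.domain) (hy : y ∈ A.domain) :
    val A (x - y) = val A x - val A y := by
  rw [val_of_mem hx, val_of_mem hy, val_of_mem (A.domain.sub_mem hx hy), ← LinearPMap.map_sub]
  rfl

/-- The orbit of a vector in `D(H)` stays in `D(A)` and `t ↦ A e^{-itH} v` is continuous. -/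
theorem IsSupersmooth.continuous_val (hH : IsSelfAdjoint H) (hA : A.IsClosed)
    (hAd : Dense (A.domain : Set E)) (hU : IsUnitaryGroup H U) (hs : IsSupersmooth H A a ε₀)
    (hε₀ : 0 < ε₀) (v : H.domain) :
    (∀ t, U t v ∈ A.domain) ∧ Continuous fun t => val A (U t (v : E)) := by
  have hε : 0 < |ε₀ / 2| := by positivity
  have hεε₀ : |ε₀ / 2| < ε₀ := by rw [abs_of_pos (by positivity)]; linarith
  have hz : (((ε₀ / 2 : ℝ) : ℂ) * I).im ≠ 0 := by simpa using hε₀.ne'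
  set z := ((ε₀ / 2 : ℝ) : ℂ) * I with hzdef
  have hmem := hs.res_mem hH hA hAd hε hεε₀
  have hv : ∀ t, U t (v : E) = res H z (U t (subSMul H z v)) := fun t => by
    rw [← hU.res_apply hH hz, res_subSMul hH hz]
  refine ⟨fun t => by rw [hv]; exact (hmem _).1, ?_⟩
  have hlip : LipschitzWith (√(a / |ε₀ / 2|)).toNNReal fun f => val A (res H z f) := by
    refine LipschitzWith.of_dist_le_mul fun f g => ?_
    rw [dist_eq_norm, dist_eq_norm, ← val_sub (hmem f).1 (hmem g).1, Real.coe_toNNReal _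
      (Real.sqrt_nonneg _)]
    have : res H z f - res H z g = res H z (f - g) := ((resCLM hH hz).map_sub f g).symm
    rw [this]
    exact (hmem _).2
  simp_rw [hv]
  exact hlip.continuous.comp (hU.continuous _)

/-- Paired with a `D(A*)`-valued step function `k`, the orbit gives `⟪Y, v⟫`, where `Y` is the
integral bounded in `norm_integral_group_le`. -/
theorem IsSupersmooth.eLpNorm_val_le (hH : IsSelfAdjoint H) (hA : A.IsClosed)
    (hAd : Dense (A.domain : Set E)) (hU : IsUnitaryGroup H U) (hs : IsSupersmooth H A a ε₀)
    (ha : 0 ≤ a) (hε₀ : 0 < ε₀) (v : H.domain) :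
    eLpNorm (fun t => val A (U t (v : E))) 2 volume ≤
      ENNReal.ofReal (√(6 * (2 * a)) * ‖(v : E)‖) := by
  obtain ⟨hmem, hcont⟩ := hs.continuous_val hH hA hAd hU hε₀ v
  refine eLpNorm_le_of_forall_step (dense_adjoint_domain hA hAd) hcont.aestronglyMeasurable
    (by positivity) fun k hk => ?_
  have hUc' : ∀ v, Continuous fun t => U (-t) v := fun v => (hU.continuous v).comp continuous_neg
  have hfint := hk.isTame.integrable A.adjoint.toFun
  have hYint : Integrable fun s => U (-s) (A.adjoint (k s)) :=
    hfint.norm.mono' (aestronglyMeasurable_group_apply hUc' (fun t v => hU.norm_map _ _)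
      aestronglyMeasurable_id hfint.1) (Eventually.of_forall fun s => (hU.norm_map _ _).le)
  have h1 : ∫ t, inner ℂ (k t : F) (val A (U t (v : E))) =
      inner ℂ (∫ s, U (-s) (A.adjoint (k s))) (v : E) := by
    rw [← integral_inner_left hYint]
    refine integral_congr_ae (Eventually.of_forall fun t => ?_)
    simp only
    rw [inner_val hAd _ (hmem t), inner_group_left hU.zero hU.add hU.norm_map, neg_neg]
  have h2 := norm_integral_group_le (T := A.adjoint.toFun) hU.zero hU.add hU.continuous hU.norm_map
    hε₀ (by positivity : 0 ≤ 2 * a)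
    (fun ε h1 h2 => by simpa using hs.laplaceBound hH hU (σ := 1) (by norm_num) h1 h2)
    (fun ε h1 h2 => by simpa using hs.laplaceBound hH hU (σ := -1) (by norm_num) h1 h2) hk
  rw [h1]
  refine (norm_inner_le_norm _ _).trans ?_
  rw [mul_right_comm]
  exact mul_le_mul_of_nonneg_right h2 (norm_nonneg _)

/-- Kato smoothing: `e^{-itH} v ∈ D(A)` for almost every `t`, with `A e^{-itH} v` in `L²`. -/
theorem IsSupersmooth.smoothing (hH : IsSelfAdjoint H) (hA : A.IsClosed)
    (hAd : Dense (A.domain : Set E)) (hU : IsUnitaryGroup H U) (hs : IsSupersmooth H A a ε₀)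
    (ha : 0 ≤ a) (hε₀ : 0 < ε₀) (v : E) :
    (∀ᵐ t : ℝ, U t v ∈ A.domain) ∧ MemLp (fun t => val A (U t v)) 2 volume := by
  obtain ⟨y, hy, hlim⟩ := mem_closure_iff_seq_limit.1 (hH.dense_domain v)
  have hm : ∀ n, ∀ t, U t (y n) ∈ A.domain := fun n =>
    (hs.continuous_val hH hA hAd hU hε₀ ⟨y n, hy n⟩).1
  have hL : ∀ n, MemLp (fun t => val A (U t (y n))) 2 volume := fun n =>
    ⟨(hs.continuous_val hH hA hAd hU hε₀ ⟨y n, hy n⟩).2.aestronglyMeasurable,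
      (hs.eLpNorm_val_le hH hA hAd hU ha hε₀ ⟨y n, hy n⟩).trans_lt ENNReal.ofReal_lt_top⟩
  set K := √(6 * (2 * a)) with hK
  have hdist : ∀ m n, dist ((hL m).toLp _) ((hL n).toLp _) ≤ K * dist (y m) (y n) := by
    intro m n
    rw [dist_eq_norm, ← MemLp.toLp_sub, Lp.norm_toLp, dist_eq_norm]
    have h1 := hs.eLpNorm_val_le hH hA hAd hU ha hε₀ (⟨y m, hy m⟩ - ⟨y n, hy n⟩)
    refine ENNReal.toReal_le_of_le_ofReal (by positivity) (le_trans (le_of_eq ?_) h1)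
    congr 1
    funext t
    simp only [Pi.sub_apply]
    rw [← val_sub (hm m t) (hm n t), ← map_sub]
    rfl
  have hcau : CauchySeq fun n => (hL n).toLp _ := by
    have hc := hlim.cauchySeq
    rw [Metric.cauchySeq_iff] at hc ⊢
    intro δ hδ
    obtain ⟨N, hN⟩ := hc (δ / (K + 1)) (by positivity)
    refine ⟨N, fun m hm n hn => (hdist m n).trans_lt ?_⟩
    have := hN m hm n hn
    rw [lt_div_iff₀ (by positivity)] at this
    nlinarith [dist_nonneg (x := y m) (y := y n)]
  obtain ⟨G, hG⟩ := cauchySeq_tendsto_of_complete hcau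
  obtain ⟨ns, hns, hae⟩ := (tendstoInMeasure_of_tendsto_Lp hG).exists_seq_tendsto_ae
  -- The `L²` limit holds almost everywhere along a subsequence, and closedness of `A` identifies it
  -- pointwise.
  have hkey : ∀ᵐ t : ℝ, U t v ∈ A.domain ∧ G t = val A (U t v) := by
    have hcoe : ∀ᵐ t : ℝ, ∀ n, (hL n).toLp _ t = val A (U t (y n)) :=
      ae_all_iff.2 fun n => (hL n).coeFn_toLp
    filter_upwards [hae, hcoe] with t ht hc
    have h1 : Tendsto (fun i => ((⟨U t (y (ns i)), hm _ t⟩ : A.domain) : E)) atTop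
        (𝓝 (U t v)) :=
      ((U t).continuous.tendsto v).comp (hlim.comp hns.tendsto_atTop)
    have h2 : Tendsto (fun i => A ⟨U t (y (ns i)), hm _ t⟩) atTop (𝓝 (G t)) := by
      refine ht.congr fun i => ?_
      rw [hc, val_of_mem (hm _ t)]
    obtain ⟨h3, h4⟩ := graph_limit hA h1 h2
    exact ⟨h3, by rw [val_of_mem h3, h4]⟩
  exact ⟨hkey.mono fun t ht => ht.1,
    (memLp_congr_ae (hkey.mono fun t ht => ht.2)).1 (Lp.memLp G)⟩

end Smoothing

/-! ### The inhomogeneous estimate -/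

section Inhomogeneous

variable {E F : Type*} [NormedAddCommGroup E] [InnerProductSpace ℂ E] [CompleteSpace E]
  [NormedAddCommGroup F] [InnerProductSpace ℂ F] [CompleteSpace F]
  {A : E →ₗ.[ℂ] F} {W : ℝ → E →L[ℂ] E}

theorem val_zero : val A (0 : E) = 0 := by
  rw [val_of_mem A.domain.zero_mem]
  exact map_zero A.toFun

/-- `W(t) v ∈ D(A)` for almost every `t`, with `A W(t) v` square integrable, for every `v`. -/
def IsSmoothing (A : E →ₗ.[ℂ] F) (W : ℝ → E →L[ℂ] E) : Prop :=
  ∀ v : E, (∀ᵐ t : ℝ, W t v ∈ A.domain) ∧ MemLp (fun t => val A (W t v)) 2 volume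

theorem IsSmoothing.neg (hK : IsSmoothing A W) : IsSmoothing A fun t => W (-t) := fun v =>
  ⟨(quasiMeasurePreserving_neg volume).ae (hK v).1,
    (hK v).2.comp_measurePreserving (Measure.measurePreserving_neg volume)⟩

/-- Reduces measurability and integrability to finitely many fixed vectors. Disjoint indicators are
used because `val A` is additive only on `D(A)`. -/
theorem IsStep.val_eq_sum {h : ℝ → A.adjoint.domain} (hh : IsStep h) (r s : ℝ) :
    val A (W r (A.adjoint (h s))) = ∑ i ∈ hh.finite_range.toFinset,
      ({s | h s = i} ∩ Function.support h).indicator (fun _ => val A (W r (A.adjoint i))) s := by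
  by_cases hs : h s = 0
  · rw [hs, LinearPMap.map_zero, map_zero, val_zero]
    refine (Finset.sum_eq_zero fun i _ => indicator_of_notMem ?_ _).symm
    exact fun h => h.2 hs
  · rw [Finset.sum_eq_single (h s)]
    · rw [indicator_of_mem]
      exact ⟨rfl, hs⟩
    · exact fun i _ hi => indicator_of_notMem (fun h => hi h.1.symm) _
    · exact fun hn => absurd (hh.finite_range.mem_toFinset.2 ⟨s, rfl⟩) hn

theorem IsSmoothing.ae_mem (hK : IsSmoothing A W) {h : ℝ → A.adjoint.domain} (hh : IsStep h)
    (t : ℝ) : ∀ᵐ s : ℝ, W (t - s) (A.adjoint (h s)) ∈ A.domain := by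
  have h1 : ∀ᵐ s : ℝ, ∀ i ∈ range h, W (t - s) (A.adjoint i) ∈ A.domain :=
    (ae_ball_iff hh.finite_range.countable).2 fun i _ =>
      (quasiMeasurePreserving_sub_left volume t).ae (hK (A.adjoint i)).1
  filter_upwards [h1] with s hs
  exact hs _ ⟨s, rfl⟩

theorem IsSmoothing.integrable (hK : IsSmoothing A W) {h : ℝ → A.adjoint.domain} (hh : IsStep h)
    (t : ℝ) : Integrable fun s => val A (W (t - s) (A.adjoint (h s))) := by
  simp_rw [hh.val_eq_sum]
  refine integrable_finsetSum _ fun i _ => ?_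
  have hS : NullMeasurableSet ({s | h s = i} ∩ Function.support h) :=
    (hh.nullMeasurableSet_preimage i).inter hh.nullMeasurableSet_support
  have hfin : IsFiniteMeasure (volume.restrict ({s | h s = i} ∩ Function.support h)) :=
    ⟨by rw [Measure.restrict_apply_univ]
        exact (measure_mono inter_subset_right).trans_lt hh.volume_support_lt_top⟩
  have h1 : MemLp (fun s => val A (W (t - s) (A.adjoint i))) 2 volume :=
    (hK (A.adjoint i)).2.comp_measurePreserving (Measure.measurePreserving_sub_left volume t)
  have h2 : Integrable (fun s => val A (W (t - s) (A.adjoint i)))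
      (volume.restrict ({s | h s = i} ∩ Function.support h)) :=
    (h1.restrict _).integrable (by norm_num)
  exact IntegrableOn.integrable_indicator₀ h2 hS

/-- The forward Duhamel integral `∫_{τ > 0} A W(τ) A* h(t - τ) dτ`. -/
noncomputable def duhamel (A : E →ₗ.[ℂ] F) (W : ℝ → E →L[ℂ] E) (h : ℝ → A.adjoint.domain) (t : ℝ) :
    F :=
  ∫ τ in Ioi (0 : ℝ), val A (W τ (A.adjoint (h (t - τ))))

theorem IsSmoothing.ae_mem' (hK : IsSmoothing A W) {h : ℝ → A.adjoint.domain} (hh : IsStep h)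
    (t : ℝ) : ∀ᵐ τ : ℝ, W τ (A.adjoint (h (t - τ))) ∈ A.domain := by
  have := (quasiMeasurePreserving_sub_left volume t).ae (hK.ae_mem hh t)
  simpa using this

theorem IsSmoothing.integrable' (hK : IsSmoothing A W) {h : ℝ → A.adjoint.domain}
    (hh : IsStep h) (t : ℝ) : Integrable fun τ => val A (W τ (A.adjoint (h (t - τ)))) := by
  have := (hK.integrable hh t).comp_sub_left t
  simpa using this

theorem IsSmoothing.aestronglyMeasurable_duhamel (hK : IsSmoothing A W)
    {h : ℝ → A.adjoint.domain} (hh : IsStep h) : AEStronglyMeasurable (duhamel A W h) := by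
  refine AEStronglyMeasurable.integral_prod_right'
    (f := fun p : ℝ × ℝ => val A (W p.2 (A.adjoint (h (p.1 - p.2))))) ?_
  simp_rw [hh.val_eq_sum]
  refine Finset.aestronglyMeasurable_fun_sum _ fun i _ => ?_
  have hS : NullMeasurableSet ({s | h s = i} ∩ Function.support h) :=
    (hh.nullMeasurableSet_preimage i).inter hh.nullMeasurableSet_support
  have h1 : AEStronglyMeasurable (fun p : ℝ × ℝ => val A (W p.2 (A.adjoint i)))
      (volume.prod (volume.restrict (Ioi 0))) :=
    AEStronglyMeasurable.comp_snd ((hK (A.adjoint i)).2.1.restrict)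
  have h2 : NullMeasurableSet
      ((fun p : ℝ × ℝ => p.1 - p.2) ⁻¹' ({s | h s = i} ∩ Function.support h))
      (volume.prod (volume.restrict (Ioi 0))) :=
    hS.preimage (quasiMeasurePreserving_sub _ _)
  exact h1.indicator₀ h2

/-- Pairing with `D(A*)` moves `A` off the integrand, leaving the `E`-valued convolution to which
the multiplier bound applies. -/
theorem inner_duhamel (hAd : Dense (A.domain : Set E)) (hWc : ∀ v, Continuous fun t => W t v)
    (hWn : ∀ t v, ‖W t v‖ = ‖v‖) (hK : IsSmoothing A W)
    {h : ℝ → A.adjoint.domain} (hh : IsStep h) (w : A.adjoint.domain) (t : ℝ) :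
    inner ℂ (w : F) (duhamel A W h t) =
      inner ℂ (A.adjoint w) (∫ τ in Ioi (0 : ℝ), W τ (A.adjoint (h (t - τ)))) := by
  have hfint := (hh.isTame.integrable A.adjoint.toFun).comp_sub_left t
  have h1 : Integrable fun τ => W τ (A.adjoint (h (t - τ))) :=
    hfint.norm.mono' (aestronglyMeasurable_group_apply hWc hWn aestronglyMeasurable_id hfint.1)
      (Eventually.of_forall fun s => (hWn _ _).le)
  rw [duhamel, ← integral_inner (hK.integrable' hh t).integrableOn, ← integral_inner h1.integrableOn]
  refine integral_congr_ae (ae_restrict_of_ae ?_)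
  filter_upwards [hK.ae_mem' hh t] with τ hτ
  exact inner_val hAd w hτ

theorem eLpNorm_duhamel_le (hA : A.IsClosed) (hAd : Dense (A.domain : Set E))
    (hWc : ∀ v, Continuous fun t => W t v) (hWn : ∀ t v, ‖W t v‖ = ‖v‖) (hK : IsSmoothing A W)
    {C ε₀ : ℝ} (hC : 0 ≤ C)
    (hB : ∀ ε, 0 < ε → ε < ε₀ → LaplaceBound A.adjoint.toFun W C ε)
    {h : ℝ → A.adjoint.domain} (hh : IsStep h) {ε : ℝ} (hε : 0 < ε) (hεε₀ : ε < ε₀) :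
    eLpNorm (fun t => Real.exp (-ε * t) • duhamel A W h t) 2 volume ≤
      ENNReal.ofReal C * eLpNorm (fun t => Real.exp (-ε * t) • (h t : F)) 2 volume := by
  have hmem : MemLp (fun t => Real.exp (-ε * t) • (h t : F)) 2 := by
    have := (hh.isTame_smul (c := fun t => ((Real.exp (-ε * t) : ℝ) : ℂ))
      (by fun_prop)).memLp A.adjoint.domain.subtype
    simp only [Complex.coe_smul] at this
    exact this
  rw [← ENNReal.ofReal_toReal hmem.2.ne, ← ENNReal.ofReal_mul hC]
  refine eLpNorm_le_of_forall_step (dense_adjoint_domain hA hAd) ?_ (by positivity) fun k hk => ?_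
  · exact (by fun_prop : Continuous fun t : ℝ => Real.exp (-ε * t)).aestronglyMeasurable.smul
      (hK.aestronglyMeasurable_duhamel hh)
  · have := norm_integral_inner_weighted_causal_le hWc hWn hε hC (hB ε hε hεε₀) hh hk.isTame
    rw [mul_assoc]
    refine le_trans (le_of_eq (congrArg norm (integral_congr_ae
      (Eventually.of_forall fun t => ?_)))) this
    simp only
    rw [← Complex.coe_smul, ← Complex.coe_smul, inner_smul_right, inner_smul_right,
      inner_duhamel hAd hWc hWn hK hh]
    rfl

theorem eLpNorm_duhamel_le' (hA : A.IsClosed) (hAd : Dense (A.domain : Set E))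
    (hWc : ∀ v, Continuous fun t => W t v) (hWn : ∀ t v, ‖W t v‖ = ‖v‖) (hK : IsSmoothing A W)
    {C ε₀ : ℝ} (hC : 0 ≤ C) (hε₀ : 0 < ε₀)
    (hB : ∀ ε, 0 < ε → ε < ε₀ → LaplaceBound A.adjoint.toFun W C ε)
    {h : ℝ → A.adjoint.domain} (hh : IsStep h) (hpos : ∀ t ≤ 0, h t = 0)
    {ε : ℝ} (hε : 0 ≤ ε) (hεε₀ : ε < ε₀) :
    eLpNorm (fun t => Real.exp (-ε * t) • duhamel A W h t) 2 volume ≤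
      ENNReal.ofReal C * eLpNorm (fun t => Real.exp (-ε * t) • (h t : F)) 2 volume := by
  rcases hε.eq_or_lt with rfl | hε
  swap
  · exact eLpNorm_duhamel_le hA hAd hWc hWn hK hC hB hh hε hεε₀
  simp only [neg_zero, zero_mul, Real.exp_zero, one_smul]
  -- The endpoint `ε = 0` follows by Fatou along these `ε`; the shift by 2 keeps them strictly below
  -- `ε₀`. As `h` vanishes for `t ≤ 0`, the weights on the right are at most 1.
  let e : ℕ → ℝ := fun n => ε₀ / (n + 2)
  have he : ∀ n, 0 < e n ∧ e n < ε₀ := fun n =>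
    ⟨by positivity, by rw [div_lt_iff₀ (by positivity)]; nlinarith [(n.cast_nonneg : (0 : ℝ) ≤ n)]⟩
  have helim : Tendsto e atTop (𝓝 0) := by
    have : Tendsto (fun n : ℕ => (n : ℝ) + 2) atTop atTop :=
      tendsto_atTop_add_const_right _ _ tendsto_natCast_atTop_atTop
    exact this.const_div_atTop ε₀
  refine (Lp.eLpNorm_lim_le_liminf_eLpNorm
    (f := fun n t => Real.exp (-e n * t) • duhamel A W h t) (fun n => ?_) _
    (Eventually.of_forall fun t => ?_)).trans
    (liminf_le_of_frequently_le' (Eventually.of_forall fun n => ?_).frequently)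
  · exact (by fun_prop : Continuous fun t : ℝ => Real.exp (-e n * t)).aestronglyMeasurable.smul
      (hK.aestronglyMeasurable_duhamel hh)
  · have h1 : Tendsto (fun n => Real.exp (-e n * t)) atTop (𝓝 1) := by
      have := ((helim.neg.mul_const t).rexp)
      simpa using this
    simpa using h1.smul_const (duhamel A W h t)
  · refine (eLpNorm_duhamel_le hA hAd hWc hWn hK hC hB hh (he n).1 (he n).2).trans ?_
    gcongr 1
    refine eLpNorm_mono fun t => ?_
    rcases le_or_gt t 0 with ht | ht
    · simp [hpos t ht]
    · rw [norm_smul, Real.norm_of_nonneg (Real.exp_pos _).le]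
      refine mul_le_of_le_one_left (norm_nonneg _) (Real.exp_le_one_iff.2 ?_)
      nlinarith [(he n).1]

/-- The Duhamel integral of the forward part of `h`. -/
theorem duhamel_indicator (h : ℝ → A.adjoint.domain) (t : ℝ) :
    duhamel A W ((Ioi (0 : ℝ)).indicator h) t =
      (Ioi (0 : ℝ)).indicator
        (fun t => ∫ s in (0 : ℝ)..t, val A (W (t - s) (A.adjoint (h s)))) t := by
  have h1 : duhamel A W ((Ioi (0 : ℝ)).indicator h) t =
      ∫ s in Ioo 0 t, val A (W (t - s) (A.adjoint (h s))) := by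
    rw [duhamel, ← integral_indicator measurableSet_Ioi, ← integral_indicator measurableSet_Ioo,
      ← integral_sub_left_eq_self _ volume t]
    refine integral_congr_ae (Eventually.of_forall fun s => ?_)
    simp only [indicator, mem_Ioi, mem_Ioo, sub_pos, sub_sub_cancel]
    by_cases h1 : s < t <;> by_cases h2 : 0 < s <;> simp [h1, h2, val_zero]
  rw [h1]
  by_cases ht : t ∈ Ioi (0 : ℝ)
  · rw [indicator_of_mem ht, intervalIntegral.integral_of_le (le_of_lt ht),
      integral_Ioc_eq_integral_Ioo]
  · rw [indicator_of_notMem ht, Ioo_eq_empty (by simpa using ht)]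
    simp

theorem eLpNorm_two_sq_eq_add {G : Type*} [NormedAddCommGroup G] {f p q : ℝ → G}
    (hp : ∀ t, 0 < t → p t = f t) (hp' : ∀ t ≤ 0, p t = 0)
    (hq : ∀ t, 0 < t → q t = f (-t)) (hq' : ∀ t ≤ 0, q t = 0) :
    eLpNorm f 2 volume ^ 2 = eLpNorm p 2 volume ^ 2 + eLpNorm q 2 volume ^ 2 := by
  have key : ∀ g : ℝ → G, eLpNorm g 2 volume ^ 2 = ∫⁻ t, ‖g t‖ₑ ^ 2 := fun g => by
    have := eLpNorm_nnreal_pow_eq_lintegral (f := g) (μ := volume) (p := 2) two_ne_zero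
    simpa using this
  rw [key, key, key, ← lintegral_add_compl _ (measurableSet_Ioi (a := (0 : ℝ)))]
  congr 1
  · rw [← lintegral_indicator measurableSet_Ioi]
    refine lintegral_congr fun t => ?_
    by_cases ht : 0 < t
    · simp [indicator, ht, hp]
    · simp [indicator, ht, hp' t (not_lt.1 ht)]
  · rw [compl_Ioi, ← setLIntegral_congr Iio_ae_eq_Iic, ← lintegral_indicator measurableSet_Iio,
      ← (Measure.measurePreserving_neg (volume : Measure ℝ)).lintegral_comp_emb
        (MeasurableEquiv.neg ℝ).measurableEmbedding]
    refine lintegral_congr fun t => ?_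
    by_cases ht : 0 < t
    · simp [indicator, ht, hq]
    · simp [indicator, ht, hq' t (not_lt.1 ht)]

theorem intervalIntegral_reflect (h : ℝ → A.adjoint.domain) (t : ℝ) :
    ∫ s in (0 : ℝ)..(-t), val A (W (-t - s) (A.adjoint (h s))) =
      -∫ s in (0 : ℝ)..t, val A (W (-(t - s)) (A.adjoint (h (-s)))) := by
  have h1 := intervalIntegral.integral_comp_neg (a := 0) (b := t)
    fun s => val A (W (-t - s) (A.adjoint (h s)))
  rw [neg_zero] at h1
  rw [intervalIntegral.integral_symm, ← h1]
  congr 1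
  refine intervalIntegral.integral_congr fun s _ => ?_
  congr 3
  ring

/-- For `t > 0` the integral sees `h` only at positive times, for `t < 0` only at negative ones. The
second case is the first for the reversed group, with a sign, and adding squared norms keeps the
constant `C` without loss. -/
theorem inhomogeneousEstimate_of_smoothing {H : E →ₗ.[ℂ] E} (hA : A.IsClosed)
    (hAd : Dense (A.domain : Set E))
    (hWc : ∀ v, Continuous fun t => propagator H t v) (hWn : ∀ t v, ‖propagator H t v‖ = ‖v‖)
    (hK : IsSmoothing A (propagator H)) {C ε₀ : ℝ} (hC : 0 ≤ C) (hε₀ : 0 < ε₀)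
    (hB : ∀ ε, 0 < ε → ε < ε₀ → LaplaceBound A.adjoint.toFun (propagator H) C ε)
    (hB' : ∀ ε, 0 < ε → ε < ε₀ →
      LaplaceBound A.adjoint.toFun (fun t => propagator H (-t)) C ε) :
    InhomogeneousEstimate H A C ε₀ := by
  intro h hh
  refine ⟨fun t => ⟨ae_restrict_of_ae (hK.ae_mem hh t), (hK.integrable hh t).intervalIntegrable⟩,
    fun ε hε hεε₀ => ?_⟩
  set V : ℝ → E →L[ℂ] E := fun t => propagator H (-t) with hV
  have hVc : ∀ v, Continuous fun t => V t v := fun v => (hWc v).comp continuous_neg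
  have hVn : ∀ t v, ‖V t v‖ = ‖v‖ := fun t v => hWn _ _
  set h₁ : ℝ → A.adjoint.domain := (Ioi (0 : ℝ)).indicator h with hh₁
  set h₂ : ℝ → A.adjoint.domain := (Ioi (0 : ℝ)).indicator fun t => h (-t) with hh₂
  have hs₁ : IsStep h₁ := hh.indicator measurableSet_Ioi
  have hs₂ : IsStep h₂ := hh.comp_neg.indicator measurableSet_Ioi
  have hz₁ : ∀ t ≤ 0, h₁ t = 0 := fun t ht => indicator_of_notMem (by simpa using ht) _
  have hz₂ : ∀ t ≤ 0, h₂ t = 0 := fun t ht => indicator_of_notMem (by simpa using ht) _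
  have hp₁ : ∀ t, 0 < t → h₁ t = h t := fun t ht => indicator_of_mem ht _
  have hp₂ : ∀ t, 0 < t → h₂ t = h (-t) := fun t ht =>
    indicator_of_mem (s := Ioi (0 : ℝ)) ht fun t => h (-t)
  have hb₁ := eLpNorm_duhamel_le' hA hAd hWc hWn hK hC hε₀ hB hs₁ hz₁ hε hεε₀
  have hb₂ := eLpNorm_duhamel_le' hA hAd hVc hVn hK.neg hC hε₀ hB' hs₂ hz₂ hε hεε₀
  set w : ℝ → F := fun t => ∫ s in (0 : ℝ)..t, integrand H A h t s with hw
  have hd₁ : ∀ t, duhamel A (propagator H) h₁ t = (Ioi (0 : ℝ)).indicator w t := fun t =>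
    duhamel_indicator h t
  have hd₂ : ∀ t, duhamel A V h₂ t = (Ioi (0 : ℝ)).indicator (fun t => -w (-t)) t := by
    intro t
    rw [duhamel_indicator]
    by_cases ht : t ∈ Ioi (0 : ℝ)
    · rw [indicator_of_mem ht, indicator_of_mem ht, hw]
      simp only [integrand]
      rw [intervalIntegral_reflect, neg_neg]
    · rw [indicator_of_notMem ht, indicator_of_notMem ht]
  have hsum₁ := eLpNorm_two_sq_eq_add (f := fun t => Real.exp (-ε * |t|) • w t)
    (p := fun t => Real.exp (-ε * t) • duhamel A (propagator H) h₁ t)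
    (q := fun t => -(Real.exp (-ε * t) • duhamel A V h₂ t))
    (fun t ht => by simp only [hd₁, indicator_of_mem (s := Ioi (0 : ℝ)) ht, abs_of_pos ht])
    (fun t ht => by
      simp only [hd₁, indicator_of_notMem (s := Ioi (0 : ℝ)) (not_lt.2 ht), smul_zero])
    (fun t ht => by
      simp only [hd₂, indicator_of_mem (s := Ioi (0 : ℝ)) ht, abs_neg, abs_of_pos ht, smul_neg,
        neg_neg])
    (fun t ht => by
      simp only [hd₂, indicator_of_notMem (s := Ioi (0 : ℝ)) (not_lt.2 ht), smul_zero, neg_zero])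
  have hneg : eLpNorm (fun t => -(Real.exp (-ε * t) • duhamel A V h₂ t)) 2 volume =
      eLpNorm (fun t => Real.exp (-ε * t) • duhamel A V h₂ t) 2 volume := eLpNorm_neg _ _ _
  rw [hneg] at hsum₁
  have hsum₂ := eLpNorm_two_sq_eq_add (f := fun t => Real.exp (-ε * |t|) • (h t : F))
    (p := fun t => Real.exp (-ε * t) • (h₁ t : F))
    (q := fun t => Real.exp (-ε * t) • (h₂ t : F))
    (fun t ht => by simp only [hp₁ t ht, abs_of_pos ht])
    (fun t ht => by simp [hz₁ t ht])
    (fun t ht => by simp only [hp₂ t ht, abs_neg, abs_of_pos ht])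
    (fun t ht => by simp [hz₂ t ht])
  have hle : eLpNorm (fun t => Real.exp (-ε * |t|) • w t) 2 volume ≤
      ENNReal.ofReal C * eLpNorm (fun t => Real.exp (-ε * |t|) • (h t : F)) 2 volume := by
    by_contra! hlt
    have h1 := ENNReal.pow_lt_pow_left two_ne_zero hlt
    rw [mul_pow, hsum₂, hsum₁, mul_add, ← mul_pow, ← mul_pow] at h1
    exact absurd h1 (not_lt.2 (add_le_add (by gcongr) (by gcongr)))
  refine ⟨⟨?_, hle.trans_lt ?_⟩, hle⟩
  · have hmeas : AEStronglyMeasurable w := by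
      have h1 : w = fun t => duhamel A (propagator H) h₁ t - duhamel A V h₂ (-t) := by
        funext t
        rw [hd₁, hd₂]
        rcases lt_trichotomy t 0 with ht | rfl | ht
        · rw [indicator_of_notMem (by simpa using ht.le), indicator_of_mem (by simpa using ht)]
          simp
        · simp [hw]
        · rw [indicator_of_mem (by simpa using ht), indicator_of_notMem (by simpa using ht.le)]
          simp
      rw [h1]
      exact (hK.aestronglyMeasurable_duhamel hs₁).sub
        ((hK.neg.aestronglyMeasurable_duhamel hs₂).comp_quasiMeasurePreserving
          (quasiMeasurePreserving_neg volume))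
    exact (by fun_prop : Continuous fun t : ℝ => Real.exp (-ε * |t|)).aestronglyMeasurable.smul
      hmeas
  · have := (hh.isTame_smul (c := fun t => ((Real.exp (-ε * |t|) : ℝ) : ℂ))
      (by fun_prop)).memLp A.adjoint.domain.subtype
    simp only [Complex.coe_smul] at this
    exact ENNReal.mul_lt_top ENNReal.ofReal_lt_top this.2

end Inhomogeneous

/-! ### From the inhomogeneous estimate back to the resolvent -/

section Converse

open Complex

variable {E F : Type*} [NormedAddCommGroup E] [InnerProductSpace ℂ E] [CompleteSpace E]
  [NormedAddCommGroup F] [InnerProductSpace ℂ F] [CompleteSpace F]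

/-- The hypothesis admits only finitely valued inputs, so the exponential is sampled on a grid whose
mesh comes from uniform continuity. Rounding down keeps the sample points in `[0, L]`. -/
theorem exists_finite_range_approx {c : ℝ → ℂ} (hc : Continuous c) {L δ : ℝ} (hδ : 0 < δ) :
    ∃ c' : ℝ → ℂ, Measurable c' ∧ (range c').Finite ∧ (∀ s ∉ Ioc 0 L, c' s = 0) ∧
      ∀ s ∈ Ioc 0 L, ‖c' s - c s‖ ≤ δ := by
  obtain ⟨η, hη, hcη⟩ := Metric.uniformContinuousOn_iff_le.1
    (isCompact_Icc.uniformContinuousOn_of_continuous (hc.continuousOn (s := Icc 0 L))) δ hδ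
  let p : ℤ → ℂ := fun n => c (η * n)
  have hpm : Measurable fun s : ℝ => p ⌊s / η⌋ :=
    (measurable_from_top (f := p)).comp (Int.measurable_floor.comp (measurable_id.div_const η))
  have hfl : ∀ s ∈ Ioc 0 L, (0 : ℝ) ≤ η * ⌊s / η⌋ ∧ η * ⌊s / η⌋ ≤ s ∧ s < η * ⌊s / η⌋ + η := by
    intro s hs
    have h1 : (0 : ℝ) ≤ s / η := div_nonneg hs.1.le hη.le
    have h2 : (0 : ℝ) ≤ ⌊s / η⌋ := by exact_mod_cast Int.floor_nonneg.2 h1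
    refine ⟨by positivity, ?_, ?_⟩
    · have := Int.floor_le (s / η)
      rwa [le_div_iff₀ hη, mul_comm] at this
    · have := Int.lt_floor_add_one (s / η)
      rw [div_lt_iff₀ hη] at this
      linarith
  refine ⟨(Ioc 0 L).indicator fun s => p ⌊s / η⌋, hpm.indicator measurableSet_Ioc, ?_,
    fun s hs => indicator_of_notMem hs _, fun s hs => ?_⟩
  · refine (((finite_Icc (0 : ℤ) ⌊L / η⌋).image p).insert 0).subset ?_
    rintro _ ⟨s, rfl⟩
    by_cases hs : s ∈ Ioc 0 L
    · rw [indicator_of_mem hs]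
      refine Or.inr ⟨⌊s / η⌋, ⟨Int.floor_nonneg.2 (div_nonneg hs.1.le hη.le), ?_⟩, rfl⟩
      exact Int.floor_le_floor (div_le_div_of_nonneg_right hs.2 hη.le)
    · exact Or.inl (indicator_of_notMem hs _)
  · rw [indicator_of_mem hs]
    obtain ⟨h1, h2, h3⟩ := hfl s hs
    have := hcη (η * ⌊s / η⌋) ⟨h1, h2.trans hs.2⟩ s ⟨hs.1.le, hs.2⟩ (by
      rw [Real.dist_eq, abs_le]; constructor <;> linarith)
    rwa [dist_eq_norm] at this

theorem volume_sign_mul_preimage {σ : ℝ} (hσ : σ ^ 2 = 1) (L : ℝ) :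
    volume ((fun t : ℝ => σ * t) ⁻¹' Ioc 0 L) = ENNReal.ofReal L := by
  rcases sq_eq_one_iff.1 hσ with rfl | rfl
  · simp
  · simp

theorem eLpNorm_le_of_bound_of_support {σ : ℝ} (hσ : σ ^ 2 = 1) {L M : ℝ} (hL : 0 ≤ L)
    {f : ℝ → F} (hf : ∀ t, σ * t ∉ Ioc 0 L → f t = 0) (hM : ∀ t, σ * t ∈ Ioc 0 L → ‖f t‖ ≤ M) :
    eLpNorm f 2 volume ≤ ENNReal.ofReal (√L * M) := by
  set B := (fun t : ℝ => σ * t) ⁻¹' Ioc 0 L with hB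
  have hBm : MeasurableSet B := measurableSet_Ioc.preimage (measurable_const_mul σ)
  have h1 : f = B.indicator f := by
    funext t
    by_cases ht : t ∈ B
    · rw [indicator_of_mem ht]
    · rw [indicator_of_notMem ht, hf t ht]
  rw [h1, eLpNorm_indicator_eq_eLpNorm_restrict hBm]
  refine (eLpNorm_le_of_ae_bound (C := M) ?_).trans ?_
  · rw [ae_restrict_iff' hBm]
    exact Eventually.of_forall hM
  · rw [Measure.restrict_apply_univ, hB, volume_sign_mul_preimage hσ,
      ENNReal.ofReal_rpow_of_nonneg hL (by positivity), ← ENNReal.ofReal_mul (by positivity),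
      Real.sqrt_eq_rpow]
    norm_num

variable {H : E →ₗ.[ℂ] E} {A : E →ₗ.[ℂ] F} {C ε₀ : ℝ}

theorem isStep_comp_sign_mul_smul {σ : ℝ} (hσ : σ ^ 2 = 1) {L : ℝ} {c : ℝ → ℂ}
    (hcm : Measurable c) (hcf : (range c).Finite) (hc0 : ∀ s ∉ Ioc 0 L, c s = 0)
    {D : Submodule ℂ F} (v : D) : IsStep fun t => c (σ * t) • v where
  aestronglyMeasurable :=
    ((hcm.comp (measurable_const_mul σ)).stronglyMeasurable.smul_const v).aestronglyMeasurable
  finite_range := (hcf.image fun x => x • v).subset (by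
    rintro _ ⟨t, rfl⟩
    exact ⟨_, ⟨_, rfl⟩, rfl⟩)
  bounded_support := by
    refine (Metric.isBounded_closedBall (x := (0 : ℝ)) (r := L)).subset fun t ht => ?_
    have h1 : σ * t ∈ Ioc 0 L := by
      by_contra hcon
      exact ht (by simp [hc0 _ hcon])
    have h2 : |t| = |σ * t| := by
      rcases sq_eq_one_iff.1 hσ with rfl | rfl <;> simp
    rw [mem_closedBall_zero_iff, Real.norm_eq_abs, h2, abs_of_pos h1.1]
    exact h1.2

theorem InhomogeneousEstimate.inner_integral (hAd : Dense (A.domain : Set E))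
    (hE : InhomogeneousEstimate H A C ε₀) {h : ℝ → A.adjoint.domain} (hh : IsStep h)
    (v : A.adjoint.domain) (t : ℝ) :
    inner ℂ (v : F) (∫ s in (0 : ℝ)..t, integrand H A h t s) =
      ∫ s in (0 : ℝ)..t, inner ℂ (A.adjoint v) (propagator H (t - s) (A.adjoint (h s))) := by
  obtain ⟨h1, h2⟩ := (hE h hh).1 t
  have h3 := (innerSL ℂ (v : F)).intervalIntegral_comp_comm h2
  simp only [innerSL_apply_apply] at h3
  rw [← h3]
  refine intervalIntegral.integral_congr_ae ?_
  rw [ae_restrict_iff' measurableSet_uIoc] at h1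
  filter_upwards [h1] with s hs hst
  exact inner_val hAd v (hs hst)

/-- The truncated form of the resolvent estimate. -/
theorem InhomogeneousEstimate.norm_integral_le (hAd : Dense (A.domain : Set E))
    (hU : IsUnitaryGroup H (propagator H)) (hC : 0 ≤ C)
    (hE : InhomogeneousEstimate H A C ε₀) {σ : ℝ} (hσ : σ ^ 2 = 1) {ε : ℝ} (hε : 0 < ε)
    (hεε₀ : ε < ε₀) {ζ : ℂ} (hζ : ζ.re = -ε) (v : A.adjoint.domain) {L : ℝ} (hL : 0 < L) :
    ‖∫ t in (0 : ℝ)..L, ∫ s in (0 : ℝ)..t, cexp (ζ * s) *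
      inner ℂ (A.adjoint v) (propagator H (σ * s) (A.adjoint v))‖ ≤ C * L * ‖(v : F)‖ ^ 2 := by
  set κ : ℝ → ℂ := fun r => inner ℂ (A.adjoint v) (propagator H (σ * r) (A.adjoint v)) with hκ
  have hκc : Continuous κ :=
    continuous_const.inner ((hU.continuous _).comp (continuous_const_mul σ))
  set B := ‖A.adjoint v‖ ^ 2 with hB
  have hB0 : 0 ≤ B := sq_nonneg _
  have hκb : ∀ r, ‖κ r‖ ≤ B := fun r => by
    refine (norm_inner_le_norm _ _).trans ?_
    rw [hU.norm_map, hB, sq]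
  have hmn : ∀ r : ℝ, ‖cexp (ζ * r)‖ = Real.exp (-ε * r) := fun r => by
    rw [Complex.norm_exp]; congr 1; simp [Complex.mul_re, hζ]
  have hσσ : ∀ r : ℝ, σ * (σ * r) = r := fun r => by rw [← mul_assoc, ← sq, hσ, one_mul]
  set Φ : ℝ → ℂ := fun t => ∫ s in (0 : ℝ)..t, cexp (ζ * s) * κ s with hΦ
  have hΦc : Continuous Φ := by
    refine intervalIntegral.continuous_primitive (fun a b => ?_) 0
    exact ((by fun_prop : Continuous fun s : ℝ => cexp (ζ * s)).mul hκc).intervalIntegrable _ _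
  have main : ∀ δ > 0, ‖∫ t in (0 : ℝ)..L, Φ t‖ ≤
      C * L * ‖(v : F)‖ ^ 2 + δ * (C * L * ‖(v : F)‖ ^ 2 + B * L * L) := by
    intro δ hδ
    -- The ideal input is `e^{-ζs} v`: convolved with `κ` and multiplied by `e^{ζr}` it gives
    -- exactly `Φ(r)`. Its weighted norm is `√L ‖v‖`, since `|e^{-ζs}| = e^{εs}` cancels the weight.
    obtain ⟨c, hcm, hcf, hc0, hcδ⟩ := exists_finite_range_approx
      (c := fun s : ℝ => cexp (-(ζ * s))) (by fun_prop) (L := L) hδ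
    set h : ℝ → A.adjoint.domain := fun t => c (σ * t) • v with hh
    have hstep : IsStep h := isStep_comp_sign_mul_smul hσ hcm hcf hc0 v
    obtain ⟨hg, hgle⟩ := (hE h hstep).2 ε hε.le hεε₀
    set w : ℝ → F := fun t => ∫ s in (0 : ℝ)..t, integrand H A h t s with hw
    set g : ℝ → F := fun t => Real.exp (-ε * |t|) • w t with hgdef
    -- Unimodular on `(0, L]`. The factor `e^{εr}` undoes the weight in `g`, and the conjugate
    -- compensates for the conjugate-linear first slot.
    set b : ℝ → ℂ := (Ioc 0 L).indicator fun r => (starRingEnd ℂ) (cexp (ζ * r) * Real.exp (ε * r))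
      with hb
    set q : ℝ → F := fun t => b (σ * t) • (v : F) with hq
    have hb1 : ∀ r, ‖b r‖ ≤ 1 := by
      intro r
      by_cases hr : r ∈ Ioc 0 L
      · rw [hb, indicator_of_mem hr, RCLike.norm_conj, norm_mul, hmn, Complex.norm_real,
          Real.norm_of_nonneg (Real.exp_pos _).le, ← Real.exp_add]
        simp
      · rw [hb, indicator_of_notMem hr, norm_zero]; exact zero_le_one
    have hbm : Measurable b := by
      refine Measurable.indicator ?_ measurableSet_Ioc
      exact (by fun_prop : Continuous fun r : ℝ =>
        (starRingEnd ℂ) (cexp (ζ * r) * Real.exp (ε * r))).measurable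
    have hqn : eLpNorm q 2 volume ≤ ENNReal.ofReal (√L * ‖(v : F)‖) := by
      refine eLpNorm_le_of_bound_of_support hσ hL.le (fun t ht => ?_) (fun t _ => ?_)
      · rw [hq]; simp only; rw [hb, indicator_of_notMem ht, zero_smul]
      · rw [hq, norm_smul]
        exact mul_le_of_le_one_left (norm_nonneg _) (hb1 _)
    have hq2 : MemLp q 2 :=
      ⟨((hbm.comp (measurable_const_mul σ)).stronglyMeasurable.smul_const _).aestronglyMeasurable,
        hqn.trans_lt ENNReal.ofReal_lt_top⟩
    have hhn : eLpNorm (fun t => Real.exp (-ε * |t|) • (h t : F)) 2 volume ≤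
        ENNReal.ofReal (√L * ((1 + δ) * ‖(v : F)‖)) := by
      refine eLpNorm_le_of_bound_of_support hσ hL.le (fun t ht => ?_) (fun t ht => ?_)
      · simp [hh, hc0 _ ht]
      · have habs : |t| = σ * t := by
          rw [← abs_of_pos ht.1]
          rcases sq_eq_one_iff.1 hσ with rfl | rfl <;> simp
        rw [hh, norm_smul, Submodule.coe_smul, norm_smul, ← mul_assoc,
          Real.norm_of_nonneg (Real.exp_pos _).le, habs]
        refine mul_le_mul_of_nonneg_right ?_ (norm_nonneg _)
        have h1 : ‖c (σ * t)‖ ≤ Real.exp (ε * (σ * t)) + δ := by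
          have h2 := norm_le_insert' (c (σ * t)) (cexp (-(ζ * ((σ * t : ℝ) : ℂ))))
          have h3 : ‖cexp (-(ζ * ((σ * t : ℝ) : ℂ)))‖ = Real.exp (ε * (σ * t)) := by
            have := hmn (-(σ * t))
            rw [Complex.ofReal_neg, mul_neg] at this
            rw [this]; congr 1; ring
          have := hcδ _ ht
          linarith
        calc Real.exp (-ε * (σ * t)) * ‖c (σ * t)‖
            ≤ Real.exp (-ε * (σ * t)) * (Real.exp (ε * (σ * t)) + δ) := by gcongr
          _ = 1 + Real.exp (-ε * (σ * t)) * δ := by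
              rw [mul_add, ← Real.exp_add, neg_mul, neg_add_cancel, Real.exp_zero]
          _ ≤ 1 + δ := by
              have : Real.exp (-ε * (σ * t)) ≤ 1 :=
                Real.exp_le_one_iff.2 (by nlinarith [ht.1])
              nlinarith
    have hpair : ‖∫ t, inner ℂ (q t) (g t)‖ ≤ C * L * (1 + δ) * ‖(v : F)‖ ^ 2 := by
      refine (norm_integral_inner_le hq2 hg).trans ?_
      have h1 := ENNReal.toReal_le_of_le_ofReal (by positivity) hqn
      have h2 : (eLpNorm g 2 volume).toReal ≤ C * (√L * ((1 + δ) * ‖(v : F)‖)) := by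
        refine ENNReal.toReal_le_of_le_ofReal (by positivity) ?_
        rw [ENNReal.ofReal_mul hC]
        exact hgle.trans (by gcongr)
      refine (mul_le_mul h1 h2 ENNReal.toReal_nonneg (by positivity)).trans_eq ?_
      linear_combination (C * (1 + δ) * ‖(v : F)‖ ^ 2) * Real.mul_self_sqrt hL.le
    set Ψ : ℝ → ℂ := fun r => cexp (ζ * r) * ∫ s in (0 : ℝ)..r, c s * κ (r - s) with hΨ
    have hinner : ∀ r, inner ℂ (q (σ * r)) (g (σ * r)) =
        (Ioc 0 L).indicator (fun r => (σ : ℂ) * Ψ r) r := by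
      intro r
      rw [hq, hgdef]
      simp only [hσσ]
      by_cases hr : r ∈ Ioc 0 L
      · have habs : |σ * r| = r := by
          rw [← abs_of_pos hr.1]
          rcases sq_eq_one_iff.1 hσ with rfl | rfl <;> simp
        have hwr : inner ℂ (v : F) (w (σ * r)) =
            (σ : ℂ) * ∫ s in (0 : ℝ)..r, c s * κ (r - s) := by
          rw [hw]
          simp only
          rw [hE.inner_integral hAd hstep v]
          have hσ0 : σ ≠ 0 := by rintro rfl; norm_num at hσ
          have h5 := intervalIntegral.integral_comp_mul_left (a := 0) (b := r)
            (fun s => inner ℂ (A.adjoint v) (propagator H (σ * r - s) (A.adjoint (h s)))) hσ0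
          rw [mul_zero] at h5
          have hinv : σ⁻¹ = σ := by
            rw [inv_eq_iff_eq_inv, eq_comm, inv_eq_of_mul_eq_one_left]; rw [← sq, hσ]
          rw [hinv] at h5
          have h6 : ∀ x : ℂ, (σ : ℂ) * (σ • x) = x := fun x => by
            rw [← Complex.coe_smul, smul_eq_mul, ← mul_assoc, ← Complex.ofReal_mul, ← sq, hσ]
            simp
          rw [← h6 (∫ s in (0 : ℝ)..(σ * r),
            inner ℂ (A.adjoint v) (propagator H (σ * r - s) (A.adjoint (h s)))), ← h5]
          congr 1
          refine intervalIntegral.integral_congr fun s _ => ?_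
          simp only [hh, hσσ, LinearPMap.map_smul, map_smul, inner_smul_right, hκ, mul_sub]
        rw [indicator_of_mem hr, habs, inner_smul_left, ← Complex.coe_smul, inner_smul_right, hwr,
          hb, indicator_of_mem hr, Complex.conj_conj, hΨ]
        have : ((Real.exp (ε * r) : ℝ) : ℂ) * ((Real.exp (-ε * r) : ℝ) : ℂ) = 1 := by
          rw [← Complex.ofReal_mul, ← Real.exp_add]; simp
        linear_combination (cexp (ζ * r) * (σ : ℂ) * ∫ s in (0 : ℝ)..r, c s * κ (r - s)) * this
      · rw [indicator_of_notMem hr, hb, indicator_of_notMem hr, zero_smul, inner_zero_left]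
    have hFint : ∫ t, inner ℂ (q t) (g t) = (σ : ℂ) * ∫ r in (0 : ℝ)..L, Ψ r := by
      have h1 := Measure.integral_comp_mul_left (fun t => inner ℂ (q t) (g t)) σ
      have h2 : |σ⁻¹| = 1 := by rcases sq_eq_one_iff.1 hσ with rfl | rfl <;> simp
      rw [h2, one_smul] at h1
      rw [← h1]
      simp_rw [hinner]
      rw [integral_indicator measurableSet_Ioc, integral_const_mul,
        intervalIntegral.integral_of_le hL.le]
    have hσn : ‖(σ : ℂ)‖ = 1 := by
      rcases sq_eq_one_iff.1 hσ with rfl | rfl <;> simp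
    have hcint : ∀ r, IntervalIntegrable (fun s => c s * κ (r - s)) volume 0 r := by
      intro r
      obtain ⟨M, hM⟩ := hcf.isBounded.exists_norm_le
      refine IntervalIntegrable.mono_fun' (g := fun _ => M * B) intervalIntegrable_const ?_
        (Eventually.of_forall fun s => ?_)
      · exact (hcm.aestronglyMeasurable.mul
          (hκc.comp (continuous_const.sub continuous_id)).aestronglyMeasurable)
      · simp only [norm_mul]
        exact mul_le_mul (hM _ ⟨s, rfl⟩) (hκb _) (norm_nonneg _)
          ((norm_nonneg _).trans (hM _ ⟨s, rfl⟩))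
    -- Replacing `e^{-ζs}` by `c` costs `δ B` per unit of `s`; the prefactor `e^{ζr}` has modulus at
    -- most 1.
    have hdiff : ∀ r ∈ Ioc 0 L, ‖Φ r - Ψ r‖ ≤ δ * B * L := by
      intro r hr
      have h1 : Φ r = cexp (ζ * r) * ∫ s in (0 : ℝ)..r, cexp (-(ζ * s)) * κ (r - s) := by
        have h2 := intervalIntegral.integral_comp_sub_left (a := 0) (b := r)
          (fun s : ℝ => cexp (ζ * s) * κ s) r
        rw [sub_self, sub_zero] at h2
        rw [hΦ]
        simp only
        rw [← h2, ← intervalIntegral.integral_const_mul]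
        refine intervalIntegral.integral_congr fun s _ => ?_
        rw [← mul_assoc, ← Complex.exp_add]
        congr 2
        push_cast
        ring
      have hcint' : IntervalIntegrable (fun s : ℝ => cexp (-(ζ * s)) * κ (r - s)) volume 0 r :=
        ((by fun_prop : Continuous fun s : ℝ => cexp (-(ζ * s))).mul
          (hκc.comp (continuous_const.sub continuous_id))).intervalIntegrable _ _
      rw [h1, hΨ]
      simp only
      rw [← mul_sub, ← intervalIntegral.integral_sub hcint' (hcint r), norm_mul, hmn]
      have h3 : ‖∫ s in (0 : ℝ)..r, (cexp (-(ζ * s)) * κ (r - s) - c s * κ (r - s))‖ ≤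
          δ * B * |r - 0| := by
        refine intervalIntegral.norm_integral_le_of_norm_le_const fun s hs => ?_
        rw [uIoc_of_le hr.1.le] at hs
        rw [← sub_mul, norm_mul, norm_sub_rev]
        exact mul_le_mul (hcδ s ⟨hs.1, hs.2.trans hr.2⟩) (hκb _) (norm_nonneg _) hδ.le
      rw [sub_zero, abs_of_pos hr.1] at h3
      have h4 : Real.exp (-ε * r) ≤ 1 := Real.exp_le_one_iff.2 (by nlinarith [hr.1])
      calc _ ≤ 1 * (δ * B * r) := mul_le_mul h4 h3 (norm_nonneg _) zero_le_one
        _ ≤ δ * B * L := by rw [one_mul]; gcongr; exact hr.2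
    have hΨint : IntervalIntegrable Ψ volume 0 L := by
      have h1 : Integrable fun t => inner ℂ (q t) (g t) := by
        refine (integral_norm_mul_norm_le hq2 hg).1.mono' (hq2.1.inner hg.1)
          (Eventually.of_forall fun t => norm_inner_le_norm _ _)
      have hσ0 : σ ≠ 0 := by rintro rfl; norm_num at hσ
      have h2 := h1.comp_mul_left' hσ0
      simp_rw [hinner] at h2
      rw [integrable_indicator_iff measurableSet_Ioc] at h2
      rw [intervalIntegrable_iff_integrableOn_Ioc_of_le hL.le]
      have h3 := h2.const_mul (σ : ℂ)
      refine h3.congr (Eventually.of_forall fun r => ?_)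
      simp only
      rw [← mul_assoc, ← Complex.ofReal_mul, ← sq, hσ]
      simp
    have hfin : ‖(∫ t in (0 : ℝ)..L, Φ t) - ∫ t in (0 : ℝ)..L, Ψ t‖ ≤ δ * B * L * |L - 0| := by
      rw [← intervalIntegral.integral_sub (hΦc.intervalIntegrable _ _) hΨint]
      refine intervalIntegral.norm_integral_le_of_norm_le_const fun r hr => ?_
      rw [uIoc_of_le hL.le] at hr
      exact hdiff r hr
    rw [sub_zero, abs_of_pos hL] at hfin
    rw [hFint, norm_mul, hσn, one_mul] at hpair
    have := norm_le_insert' (∫ t in (0 : ℝ)..L, Φ t) (∫ t in (0 : ℝ)..L, Ψ t)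
    linarith
  have hX : 0 ≤ C * L * ‖(v : F)‖ ^ 2 + B * L * L := by positivity
  refine le_of_forall_pos_le_add fun η hη => ?_
  refine (main (η / (C * L * ‖(v : F)‖ ^ 2 + B * L * L + 1)) (by positivity)).trans ?_
  gcongr
  rw [div_mul_eq_mul_div, div_le_iff₀ (by positivity)]
  nlinarith

/-- The truncated transforms converge exponentially to the full one `X`, so replacing them by `X`
under the integral over `[0, L]` costs an amount independent of `L`. Large `L` removes it, with no
loss in `C`. -/
theorem InhomogeneousEstimate.isSupersmooth (hH : IsSelfAdjoint H)
    (hAd : Dense (A.domain : Set E)) (hC : 0 ≤ C) (hE : InhomogeneousEstimate H A C ε₀) :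
    IsSupersmooth H A C ε₀ := by
  intro ε lam hε hεε₀ v
  have hU := isUnitaryGroup_propagator hH
  obtain ⟨σ, hσ, hσε⟩ : ∃ σ : ℝ, σ ^ 2 = 1 ∧ σ * ε = |ε| := by
    rcases abs_cases ε with ⟨h1, -⟩ | ⟨h1, -⟩
    · exact ⟨1, by norm_num, by rw [h1, one_mul]⟩
    · exact ⟨-1, by norm_num, by rw [h1, neg_one_mul]⟩
  set z : ℂ := lam + ε * I with hz
  have hzim : z.im = ε := by simp [hz]
  set ζ : ℂ := I * σ * z with hζdef
  have hζ : ζ.re = -|ε| := by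
    rw [hζdef, ← hσε]; simp [hz, Complex.mul_re, Complex.mul_im]
  obtain ⟨hint, hlap⟩ := hU.integral_Ioi hH hσ (z := z) (by rw [hzim, hσε]; exact hε)
    (A.adjoint v)
  set f : ℝ → ℂ := fun s => cexp (ζ * s) *
      inner ℂ (A.adjoint v) (propagator H (σ * s) (A.adjoint v)) with hf
  have hf' : ∀ s : ℝ, f s =
      inner ℂ (A.adjoint v) (cexp (ζ * s) • propagator H (σ * s) (A.adjoint v)) := fun s => by
    rw [inner_smul_right]
  have hfint : IntegrableOn f (Ioi 0) := by
    have := hint.const_inner (𝕜 := ℂ) (A.adjoint v)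
    exact this.congr (Eventually.of_forall fun s => (hf' s).symm)
  set X := ∫ s in Ioi (0 : ℝ), f s with hX
  have hXeq : ‖X‖ = ‖inner ℂ (res H z (A.adjoint v)) (A.adjoint v)‖ := by
    rw [hX]
    simp_rw [hf']
    rw [integral_inner hint, hlap, inner_smul_right, norm_mul, norm_inner_symm]
    have : ‖-(I * (σ : ℂ))‖ = 1 := by
      rcases sq_eq_one_iff.1 hσ with rfl | rfl <;> simp
    rw [this, one_mul]
  rw [← hXeq]
  set B := ‖A.adjoint v‖ ^ 2 with hB
  have hfb : ∀ s : ℝ, ‖f s‖ ≤ B * Real.exp (-|ε| * s) := by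
    intro s
    rw [hf, norm_mul, Complex.norm_exp, mul_comm]
    refine mul_le_mul ?_ (le_of_eq ?_) (Real.exp_pos _).le (sq_nonneg _)
    · refine (norm_inner_le_norm _ _).trans ?_
      rw [hU.norm_map, hB, sq]
    · congr 1; simp [Complex.mul_re, hζ]
  have htail : ∀ t, 0 ≤ t → ‖X - ∫ s in (0 : ℝ)..t, f s‖ ≤ B / |ε| * Real.exp (-|ε| * t) := by
    intro t ht
    have h1 : X - ∫ s in (0 : ℝ)..t, f s = ∫ s in Ioi t, f s := by
      rw [sub_eq_iff_eq_add', hX, intervalIntegral.integral_of_le ht,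
        ← setIntegral_union (Ioc_disjoint_Ioi le_rfl) measurableSet_Ioi
          (hfint.mono_set Ioc_subset_Ioi_self) (hfint.mono_set (Ioi_subset_Ioi ht)),
        Ioc_union_Ioi_eq_Ioi ht]
    rw [h1]
    refine (norm_integral_le_of_norm_le ((exp_neg_integrableOn_Ioi t hε).const_mul B)
      (Eventually.of_forall hfb)).trans_eq ?_
    rw [integral_const_mul, integral_exp_mul_Ioi (neg_neg_of_pos hε)]
    ring
  have hkey : ∀ L > 0, L * ‖X‖ ≤ L * (C * ‖(v : F)‖ ^ 2) + B / |ε| / |ε| := by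
    intro L hL
    have h1 := hE.norm_integral_le hAd hU hC hσ hε hεε₀ hζ v hL
    have hfii : ∀ a b, IntervalIntegrable f volume a b := fun a b =>
      ((by fun_prop : Continuous fun s : ℝ => cexp (ζ * s)).mul (continuous_const.inner
        ((hU.continuous _).comp (continuous_const_mul σ)))).intervalIntegrable _ _
    have hΦc : Continuous fun t => ∫ s in (0 : ℝ)..t, f s :=
      intervalIntegral.continuous_primitive hfii 0
    have h2 : (∫ t in (0 : ℝ)..L, X) - ∫ t in (0 : ℝ)..L, ∫ s in (0 : ℝ)..t, f s =
        ∫ t in (0 : ℝ)..L, (X - ∫ s in (0 : ℝ)..t, f s) :=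
      (intervalIntegral.integral_sub intervalIntegrable_const
        (hΦc.intervalIntegrable _ _)).symm
    have h3 : ‖∫ t in (0 : ℝ)..L, (X - ∫ s in (0 : ℝ)..t, f s)‖ ≤ B / |ε| / |ε| := by
      rw [intervalIntegral.integral_of_le hL.le]
      have hi : IntegrableOn (fun t => B / |ε| * Real.exp (-|ε| * t)) (Ioi 0) :=
        (exp_neg_integrableOn_Ioi 0 hε).const_mul (B / |ε|)
      refine (norm_integral_le_of_norm_le (hi.mono_set Ioc_subset_Ioi_self) ?_).trans ?_
      · rw [ae_restrict_iff' measurableSet_Ioc]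
        exact Eventually.of_forall fun t ht => htail t ht.1.le
      · refine (setIntegral_mono_set hi (Eventually.of_forall fun t => by positivity)
          Ioc_subset_Ioi_self.eventuallyLE).trans_eq ?_
        rw [integral_const_mul, integral_exp_mul_Ioi (neg_neg_of_pos hε)]
        simp
        ring
    rw [← h2, intervalIntegral.integral_const, sub_zero] at h3
    have h4 := norm_le_insert' (L • X) (∫ t in (0 : ℝ)..L, ∫ s in (0 : ℝ)..t, f s)
    rw [norm_smul, Real.norm_of_nonneg hL.le] at h4
    calc L * ‖X‖ ≤ _ := h4
      _ ≤ C * L * ‖(v : F)‖ ^ 2 + B / |ε| / |ε| := add_le_add h1 h3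
      _ = _ := by ring
  by_contra! hcon
  set Δ := ‖X‖ - C * ‖(v : F)‖ ^ 2 with hΔ
  have hΔ0 : 0 < Δ := sub_pos.2 hcon
  have hB' : 0 ≤ B / |ε| / |ε| := by positivity
  -- This `L` makes the excess `L Δ` surpass the fixed error `B / ε²` by 1.
  have h1 := hkey ((B / |ε| / |ε| + 1) / Δ) (by positivity)
  have h2 : (B / |ε| / |ε| + 1) / Δ * Δ = B / |ε| / |ε| + 1 := div_mul_cancel₀ _ hΔ0.ne'
  have h3 : (B / |ε| / |ε| + 1) / Δ * Δ = (B / |ε| / |ε| + 1) / Δ * ‖X‖ -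
      (B / |ε| / |ε| + 1) / Δ * (C * ‖(v : F)‖ ^ 2) := by rw [← mul_sub]
  linarith

end Converse

end KatoSmoothing

theorem theorem2p2 {E F : Type*}
    [NormedAddCommGroup E] [InnerProductSpace ℂ E] [CompleteSpace E]
    [NormedAddCommGroup F] [InnerProductSpace ℂ F] [CompleteSpace F]
    (H : E →ₗ.[ℂ] E) (hH : IsSelfAdjoint H)
    (A : E →ₗ.[ℂ] F) (hA : A.IsClosed) (hAd : Dense (A.domain : Set E))
    (a ε₀ : ℝ) (ha : 0 ≤ a) (hε₀ : 0 < ε₀) :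
    (KatoSmoothing.IsSupersmooth H A a ε₀ →
      (∀ v : E, ∀ᵐ t : ℝ, KatoSmoothing.propagator H t v ∈ A.domain) ∧
      KatoSmoothing.InhomogeneousEstimate H A (2 * a) ε₀) ∧
    (KatoSmoothing.InhomogeneousEstimate H A (2 * a) ε₀ →
      KatoSmoothing.IsSupersmooth H A (2 * a) ε₀) := by
  have hU := KatoSmoothing.isUnitaryGroup_propagator hH
  refine ⟨fun hs => ?_, fun hE => hE.isSupersmooth hH hAd (by positivity)⟩
  have hK : KatoSmoothing.IsSmoothing A (KatoSmoothing.propagator H) :=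
    fun v => hs.smoothing hH hA hAd hU ha hε₀ v
  refine ⟨fun v => (hK v).1, KatoSmoothing.inhomogeneousEstimate_of_smoothing hA hAd hU.continuous
    hU.norm_map hK (by positivity) hε₀ (fun ε h1 h2 => ?_) (fun ε h1 h2 => ?_)⟩
  · simpa using hs.laplaceBound hH hU (σ := 1) (by norm_num) h1 h2
  · simpa using hs.laplaceBound hH hU (σ := -1) (by norm_num) h1 h2
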